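/- **Setting.** Let $0<q<1$, $0<\alpha<1$, $m>0$, $0<T<\infty$. Let $\mathcal L$ be a self-adjoint operator on a separable Hilbert space $H$ with an orthonormal basis of eigenvectors $(\psi_k)_{k\in I}$, $I$ countable, $\mathcal L\psi_k=\lambda_k\psi_k$, $\lambda_k\ge 0$. For $d\in\mathbb R$ let $\mathcal H^d_{\mathcal L}$ be the space of series $a=\sum_k a_k\psi_k$ with $$\|a\|^2_{\mathcal H^d_{\mathcal L}}=\sum_{k\in I}(1+\lambda_k)^d|a_k|^2<\infty .$$ For $d\ge0$ this is $\{v\in H:(I+\mathcal L)^{d/2}v\in H\}$, with $a_k=\langle v,\psi_k\rangle$; for $d<0$ it is the completion of $H$ in this norm. The operator acts by $\mathcal La=\sum_k\lambda_ka_k\psi_k$. Write $(a;q)_\infty=\prod_{k\ge0}(1-q^ka)$, $\Gamma_q(x)=\frac{(q;q)_\infty}{(q^x;q)_\infty}(1-q)^{1-x}$, $D_qu(t)=\frac{u(t)-u(qt)}{(1-q)t}$, $\int_0^t g\,d_qs=(1-q)t\sum_{n\ge0}q^ng(tq^n)$, and $${}^cD^\alpha_qu(t)=\frac1{\Gamma_q(1-\alpha)}\int_0^t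 t^{-\alpha}\frac{(qs/t;q)_\infty}{(q^{1-\alpha}s/t;q)_\infty}\,D_qu(s)\,d_qs .$$ Let $e_{\alpha,1}(z;q)$ be the real-analytic function on $(-\infty,(1-q)^{-\alpha})$ which equals $\sum_{k\ge0}z^k/\Gamma_q(\alpha k+1)$ for $|z|(1-q)^\alpha<1$. The space $L^\infty_q([0,T];\mathcal H^{s}_{\mathcal L})$ consists of the functions $u:[0,T]\to\mathcal H^s_{\mathcal L}$ that are bounded. The space $W^\alpha_q([0,T];\mathcal H^s_{\mathcal L})$ consists of the bounded functions $u:[0,T]\to\mathcal H^s_{\mathcal L}$ that are $q$-regular at $0$ (that is, $u(tq^n)\to u(0)$ in $\mathcal H^s_{\mathcal L}$ as $n\to\infty$, for every $t\in(0,T]$), for which the Jackson sum defining ${}^cD^\alpha_qu(t)$ converges absolutely in $\mathcal H^s_{\mathcal L}$ for every $t\in(0,T]$, and for which ${}^cD^\alpha_qu$ is bounded on $(0,T]$ with values in $\mathcal H^s_{\mathcal L}$. **Theorem 5.1.** There is a constant $C>0$, depending only on $q,\alpha,m,T$ and $\mathcal L$, such that for all $d\in\mathbb R$ and all $\varphi,\rho\in\mathcal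 H^{d+2}_{\mathcal L}$ the following holds. There is a unique pair $(u,f)$, with $u\in L^\infty_q([0,T];\mathcal H^{d+2}_{\mathcal L})\cap W^\alpha_q([0,T];\mathcal H^d_{\mathcal L})$ and $f$ a series $\sum_kf_k\psi_k$ independent of $t$, such that $${}^cD^\alpha_qu(t)+\mathcal Lu(t)+mu(t)=f\quad(0<t\le T),\qquad u(0)=\varphi,\qquad u(T)=\rho .$$ Moreover $f\in\mathcal H^d_{\mathcal L}$; if $d\ge0$, then $u(t)$ lies in the domain of $\mathcal L$ for $0<t\le T$, $f\in H$, and the equation, including the absolute convergence of the Jackson sum, holds in $H$. All numbers $1-e_{\alpha,1}(-(\lambda_k+m)T^\alpha;q)$ are positive, and $$u(t)=\varphi+\sum_{k\in I}\frac{[\varphi_k-\rho_k]\,[e_{\alpha,1}(-(\lambda_k+m)t^\alpha;q)-1]}{1-e_{\alpha,1}(-(\lambda_k+m)T^\alpha;q)}\,\psi_k\qquad(0\le t\le T),$$ $$f=\mathcal L\varphi+m\varphi-\sum_{k\in I}\frac{(\lambda_k+m)[\varphi_k-\rho_k]}{1-e_{\alpha,1}(-(\lambda_k+m)T^\alpha;q)}\,\psi_k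 ,$$ with convergence in $\mathcal H^{d+2}_{\mathcal L}$ and in $\mathcal H^d_{\mathcal L}$ respectively. Finally $$\|{}^cD^\alpha_qu(t)\|^2_{\mathcal H^d_{\mathcal L}}+\|u(t)\|^2_{\mathcal H^{d+2}_{\mathcal L}}\le C\left(\|\varphi\|^2_{\mathcal H^{d+2}_{\mathcal L}}+\|\rho\|^2_{\mathcal H^{d+2}_{\mathcal L}}\right)\quad(0<t\le T),$$ $$\|f\|^2_{\mathcal H^d_{\mathcal L}}\le C\left(\|\varphi\|^2_{\mathcal H^{d+2}_{\mathcal L}}+\|\rho\|^2_{\mathcal H^{d+2}_{\mathcal L}}\right).$$ -/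

import Mathlib

open Filter Topology Set
open scoped InnerProductSpace

noncomputable section

/-! ### Scalar quantum calculus -/

/-- The infinite `q`-shifted factorial `(a; q)_∞ = ∏_{k ≥ 0} (1 - q ^ k a)`, for `0 < q < 1`. -/
def qPochInf (q a : ℝ) : ℝ := ∏' k : ℕ, (1 - q ^ k * a)

/-- The `q`-gamma function `Γ_q(x) = (q; q)_∞ / (q ^ x; q)_∞ * (1 - q) ^ (1 - x)`. -/
def qGamma (q x : ℝ) : ℝ := qPochInf q q / qPochInf q (q ^ x) * (1 - q) ^ (1 - x)

/-- The `q`-power `(x - q s)_q ^ (β - 1) = x ^ (β - 1) (q s / x; q)_{β - 1}`, where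
`(a; q)_γ = (a; q)_∞ / (q ^ γ a; q)_∞`. -/
def qKernel (q β x s : ℝ) : ℝ :=
  x ^ (β - 1) * (qPochInf q (q * s / x) / qPochInf q (q ^ (β - 1) * (q * s / x)))

/-- `E` is the `q`-Mittag-Leffler function `z ↦ e_{α, β}(z; q)` on `(-∞, (1 - q) ^ (-α))`: it is the
sum of the power series `∑ z ^ k / Γ_q(α k + β)` on the disc of convergence `|z (1 - q) ^ α| < 1`,
and it is real analytic on the whole half-line, so it continues this sum to all negative `z`. -/
structure IsQMittagLeffler (q α β : ℝ) (E : ℝ → ℝ) : Prop where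
  hasSum : ∀ z : ℝ, |z * (1 - q) ^ α| < 1 →
    HasSum (fun k : ℕ => z ^ k / qGamma q (α * k + β)) (E z)
  analytic : AnalyticOnNhd ℝ E (Iio ((1 - q) ^ (-α)))

open Classical in
/-- The `q`-Mittag-Leffler function `e_{α, β}(z; q)` for real `z < (1 - q) ^ (-α)`: the analytic
continuation of the power series `∑ z ^ k / Γ_q(α k + β)` along the real axis. -/
def qMittagLeffler (q α β z : ℝ) : ℝ :=
  if h : ∃ E : ℝ → ℝ, IsQMittagLeffler q α β E then h.choose z else 0

/-- The analytic continuation is unique. -/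
theorem IsQMittagLeffler.eqOn {q α β : ℝ} (hq : q < 1) {E F : ℝ → ℝ}
    (hE : IsQMittagLeffler q α β E) (hF : IsQMittagLeffler q α β F) :
    EqOn E F (Iio ((1 - q) ^ (-α))) := by
  have h0 : (0 : ℝ) ∈ Iio ((1 - q) ^ (-α)) := Real.rpow_pos_of_pos (by linarith) _
  refine hE.analytic.eqOn_of_preconnected_of_eventuallyEq hF.analytic isPreconnected_Iio h0 ?_
  have hc : ContinuousAt (fun z : ℝ => |z * (1 - q) ^ α|) 0 := by fun_prop
  have : ∀ᶠ z in 𝓝 (0 : ℝ), |z * (1 - q) ^ α| < 1 :=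
    hc.eventually_lt continuousAt_const (by simp)
  filter_upwards [this] with z hz
  exact (hE.hasSum z hz).unique (hF.hasSum z hz)

theorem IsQMittagLeffler.qMittagLeffler_eqOn {q α β : ℝ} (hq : q < 1) {E : ℝ → ℝ}
    (hE : IsQMittagLeffler q α β E) :
    EqOn (qMittagLeffler q α β) E (Iio ((1 - q) ^ (-α))) := by
  intro z hz
  have h : ∃ E : ℝ → ℝ, IsQMittagLeffler q α β E := ⟨E, hE⟩
  rw [qMittagLeffler, dif_pos h]
  exact h.choose_spec.eqOn hq hE hz

/-! ### Vector-valued quantum calculus -/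

section Vector

variable (𝕜 : Type*) [RCLike 𝕜] {E : Type*} [AddCommGroup E] [Module 𝕜 E] [TopologicalSpace E]

/-- The `q`-derivative `D_q u (t) = (u t - u (q t)) / (t (1 - q))`. -/
def qDeriv (q : ℝ) (u : ℝ → E) (t : ℝ) : E :=
  (((t * (1 - q))⁻¹ : ℝ) : 𝕜) • (u t - u (q * t))

/-- The terms `q ^ n g(a q ^ n)` of the Jackson integral of `g` over `[0, a]`. -/
def jacksonTerm (q a : ℝ) (g : ℝ → E) (n : ℕ) : E :=
  ((q ^ n : ℝ) : 𝕜) • g (a * q ^ n)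

/-- The Jackson integral `∫_0^a g d_q s = (1 - q) a ∑ q ^ n g(a q ^ n)`. -/
def jacksonIntegral (q a : ℝ) (g : ℝ → E) : E :=
  (((1 - q) * a : ℝ) : 𝕜) • ∑' n : ℕ, jacksonTerm 𝕜 q a g n

/-- The integrand `(x - q s)_q ^ (β - 1) g(s)` of the Riemann-Liouville integral at `x`. -/
def rlIntegrand (q β : ℝ) (g : ℝ → E) (x s : ℝ) : E :=
  ((qKernel q β x s : ℝ) : 𝕜) • g s

/-- The Riemann-Liouville `q`-integral of order `β > 0` with base point `0`. -/
def rlIntegral (q β : ℝ) (g : ℝ → E) (x : ℝ) : E :=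
  (((qGamma q β)⁻¹ : ℝ) : 𝕜) • jacksonIntegral 𝕜 q x (rlIntegrand 𝕜 q β g x)

/-- The terms of the Jackson sum that defines the Caputo derivative of order `α` of `u` at `t`. -/
def caputoTerm (q α : ℝ) (u : ℝ → E) (t : ℝ) (n : ℕ) : E :=
  jacksonTerm 𝕜 q t (rlIntegrand 𝕜 q (⌈α⌉₊ - α) ((qDeriv 𝕜 q)^[⌈α⌉₊] u) t) n

/-- The Caputo `q`-derivative `I_q ^ (⌈α⌉ - α) D_q ^ ⌈α⌉ u` of noninteger order `α > 0`. -/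
def caputo (q α : ℝ) (u : ℝ → E) (t : ℝ) : E :=
  rlIntegral 𝕜 q (⌈α⌉₊ - α) ((qDeriv 𝕜 q)^[⌈α⌉₊] u) t

end Vector

/-! ### The Sobolev scale of a positive operator with discrete spectrum

Throughout `ψ` is an orthonormal basis of eigenvectors with eigenvalues `lam k ≥ 0`. A family
`a : ι → 𝕜` stands for the formal eigenfunction series `∑ a k ψ_k`; the space of these series is
given the product topology (coefficientwise convergence), and contains `H` through the Fourier
coefficients. -/

section Scale

variable {ι 𝕜 : Type*} [RCLike 𝕜]

/-- The formal series of a vector: its Fourier coefficients `⟨v, ψ_k⟩`. -/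
def eigenSeries {H : Type*} [NormedAddCommGroup H] [InnerProductSpace 𝕜 H]
    (ψ : HilbertBasis ι 𝕜 H) (v : H) : ι → 𝕜 := fun k => ⟪ψ k, v⟫_𝕜

/-- The action of the operator on formal series: `∑ a k ψ_k ↦ ∑ lam k * a k ψ_k`. -/
def seriesOp (lam : ι → ℝ) (a : ι → 𝕜) : ι → 𝕜 := fun k => (lam k : 𝕜) * a k

/-- Membership in the Sobolev space of order `d`. -/
def MemSobolev (lam : ι → ℝ) (d : ℝ) (a : ι → 𝕜) : Prop :=
  Summable fun k => (1 + lam k) ^ d * ‖a k‖ ^ 2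

/-- The Sobolev norm `(∑ (1 + lam k) ^ d |a k| ^ 2) ^ (1 / 2)` of order `d`. -/
def sobolevNorm (lam : ι → ℝ) (d : ℝ) (a : ι → 𝕜) : ℝ :=
  √(∑' k, (1 + lam k) ^ d * ‖a k‖ ^ 2)

/-- The family `g` sums (unconditionally) to `a` in the Sobolev space of order `d`. -/
def SobolevHasSum (lam : ι → ℝ) (d : ℝ) (g : ι → ι → 𝕜) (a : ι → 𝕜) : Prop :=
  MemSobolev lam d a ∧ (∀ k, MemSobolev lam d (g k)) ∧
    Tendsto (fun s : Finset ι => sobolevNorm lam d (a - ∑ k ∈ s, g k)) atTop (𝓝 0)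

/-- For `d ≥ 0` the Sobolev space of order `d` consists of (the series of) vectors of `H`. -/
theorem MemSobolev.exists_eigenSeries_eq {H : Type*} [NormedAddCommGroup H] [InnerProductSpace 𝕜 H]
    (ψ : HilbertBasis ι 𝕜 H) {lam : ι → ℝ} (hlam : ∀ k, 0 ≤ lam k) {d : ℝ} (hd : 0 ≤ d)
    {a : ι → 𝕜} (ha : MemSobolev lam d a) : ∃ v : H, eigenSeries ψ v = a := by
  have h2 : Summable fun k => ‖a k‖ ^ 2 := by
    refine Summable.of_nonneg_of_le (fun k => by positivity) (fun k => ?_) ha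
    have : 1 ≤ (1 + lam k) ^ d := Real.one_le_rpow (by linarith [hlam k]) hd
    nlinarith [sq_nonneg ‖a k‖]
  have hm : Memℓp a 2 := by
    refine memℓp_gen ?_
    simpa using h2
  refine ⟨ψ.repr.symm ⟨a, hm⟩, ?_⟩
  funext k
  rw [eigenSeries, ← HilbertBasis.repr_apply_apply, LinearIsometryEquiv.apply_symm_apply]

/-- On its domain, a self-adjoint operator with eigenvectors `ψ k` acts on series by `seriesOp`. -/
theorem eigenSeries_apply_eq_seriesOp {H : Type*} [NormedAddCommGroup H] [InnerProductSpace 𝕜 H]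
    [CompleteSpace H] {L : H →ₗ.[𝕜] H} (hL : IsSelfAdjoint L) (ψ : HilbertBasis ι 𝕜 H)
    {lam : ι → ℝ} (hψ : ∀ k, ∃ h : ψ k ∈ L.domain, L ⟨ψ k, h⟩ = (lam k : 𝕜) • ψ k)
    (v : L.domain) : eigenSeries ψ (L v) = seriesOp lam (eigenSeries ψ (v : H)) := by
  funext k
  obtain ⟨h, hk⟩ := hψ k
  have h1 := LinearPMap.adjoint_isFormalAdjoint hL.dense_domain
  rw [LinearPMap.isSelfAdjoint_def.1 hL] at h1
  have h2 := h1 ⟨ψ k, h⟩ v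
  rw [hk, inner_smul_left] at h2
  simp only [eigenSeries, seriesOp]
  simpa using h2.symm

/-! ### Function spaces and the inverse source problem -/

/-- `u ∈ L_q^∞([0, T]; H^s)`: values in `H^s`, and a bounded `H^s` norm on `[0, T]`. -/
def MemLinfty (lam : ι → ℝ) (T s : ℝ) (u : ℝ → ι → 𝕜) : Prop :=
  (∀ t ∈ Icc 0 T, MemSobolev lam s (u t)) ∧
    BddAbove ((fun t => sobolevNorm lam s (u t)) '' Icc 0 T)

/-- `u ∈ W_q^α([0, T]; H^s)`: `u` and its Caputo `q`-derivative are bounded with values in `H^s`.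
As always for `q`-difference equations with data at `0`, functions are `q`-regular at `0`, that is,
`u (t q ^ n) → u 0`, and the Jackson sums converge absolutely. -/
structure MemW (lam : ι → ℝ) (q α T s : ℝ) (u : ℝ → ι → 𝕜) : Prop where
  memLinfty : MemLinfty lam T s u
  regular : ∀ t ∈ Ioc 0 T,
    Tendsto (fun n : ℕ => sobolevNorm lam s (u (t * q ^ n) - u 0)) atTop (𝓝 0)
  summable : ∀ t ∈ Ioc 0 T, Summable fun n : ℕ => sobolevNorm lam s (caputoTerm 𝕜 q α u t n)
  caputo_mem : ∀ t ∈ Ioc 0 T, MemSobolev lam s (caputo 𝕜 q α u t)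
  caputo_bdd : BddAbove ((fun t => sobolevNorm lam s (caputo 𝕜 q α u t)) '' Ioc 0 T)

/-- The pair `(u, f)` is a generalised solution, of order `d`, of the inverse source problem
`ᶜD_q^α u + L u + m u = f` on `(0, T]`, `u 0 = φ`, `u T = ρ`. -/
structure IsInverseSolution (lam : ι → ℝ) (q α m T d : ℝ) (φ ρ : ι → 𝕜)
    (u : ℝ → ι → 𝕜) (f : ι → 𝕜) : Prop where
  memLinfty : MemLinfty lam T (d + 2) u
  memW : MemW lam q α T d u
  equation : ∀ t ∈ Ioc 0 T, caputo 𝕜 q α u t + seriesOp lam (u t) + (m : 𝕜) • u t = f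
  initial : u 0 = φ
  final : u T = ρ

end Scale

end

noncomputable section

/-! ### The `q`-shifted factorial and Euler's expansion -/

section QPoch

variable {q : ℝ}

/-! The problem splits into scalar problems with `μ = λ_k + m ≥ m`; the point is to control them
uniformly in `μ`. On the lattice `t q^n` the Caputo derivative is `t^(-α) / Γ_q(1-α) * ∑ K_n (u(t
q^n) - u(t q^(n+1)))`, with a positive decreasing kernel `K_n`. Two facts about this sum carry the
proof.

Eigenfunctions. Euler's expansion `(q x; q)_∞ = ∑ b_j x^j` turns the Mittag-Leffler series into the
partial fractions `(q; q)_∞⁻¹ ∑ b_j / (1 - w q^(α j))`, `w = z (1-q)^α`, which also provide the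
analytic continuation. Inserting them in the lattice sum, regrouping along antidiagonals and summing
by parts shows that `e_{α,1}(-μ t^α; q)` is an eigenfunction with eigenvalue `-μ`
(`hasSum_latticeKernel_mlSeries`).

Maximum principle. Since `K` decreases, the homogeneous equation at a lattice point makes `(K_0 + c)
a_0`, with `c = μ t^α Γ_q(1-α)`, a combination of the values nearer to `0` with nonnegative weights
of total at most `K_0`. Hence `(K_0 + c) |a_0| ≤ K_0 |lim a_n|` (`norm_le_norm_limit_of_kernel`).
For the Mittag-Leffler function the limit is `1`, which bounds it by `1` and keeps `1 - e_{α,1}(-μ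
T^α; q)` above a positive constant for all `μ ≥ m` (`modeGap_le`). For the difference of two
solutions, shifted by the stationary solution `h / μ`, the same inequality at `t = T` forces `h =
0`, and then the difference vanishes.

Existence and the estimates are now termwise multiplier bounds, a factor `λ_k + m` costing two
Sobolev orders. The multipliers do not involve `d`, so neither does the constant. -/

theorem summable_qPoch_factor (hq0 : 0 < q) (hq1 : q < 1) (a : ℝ) :
    Summable fun k : ℕ => -(q ^ k * a) :=
  ((summable_geometric_of_lt_one hq0.le hq1).mul_right a).neg

theorem multipliable_qPochInf (hq0 : 0 < q) (hq1 : q < 1) (a : ℝ) :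
    Multipliable fun k : ℕ => 1 - q ^ k * a := by
  simpa [sub_eq_add_neg] using
    Real.multipliable_one_add_of_summable (summable_qPoch_factor hq0 hq1 a)

theorem qPochInf_eq_mul (hq0 : 0 < q) (hq1 : q < 1) (a : ℝ) :
    qPochInf q a = (1 - a) * qPochInf q (q * a) := by
  have h : (fun k : ℕ => 1 - q ^ (k + 1) * a) = fun k => 1 - q ^ k * (q * a) := by
    funext k; ring
  have hm : Multipliable fun k : ℕ => 1 - q ^ (k + 1) * a := by
    rw [h]; exact multipliable_qPochInf hq0 hq1 _
  rw [qPochInf, tprod_eq_zero_mul' (f := fun k : ℕ => 1 - q ^ k * a) hm, h, qPochInf]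
  simp

theorem qPochInf_pos (hq0 : 0 < q) (hq1 : q < 1) {a : ℝ} (ha : a < 1) :
    0 < qPochInf q a := by
  have hpos : ∀ k : ℕ, 0 < 1 + -(q ^ k * a) := by
    intro k
    have h1 : q ^ k ≤ 1 := pow_le_one₀ hq0.le hq1.le
    have h2 : 0 < q ^ k := pow_pos hq0 k
    rcases le_or_gt a 0 with h | h <;> nlinarith
  have := Real.rexp_tsum_eq_tprod hpos
    (Real.summable_log_one_add_of_summable (summable_qPoch_factor hq0 hq1 a))
  rw [qPochInf]
  simp only [sub_eq_add_neg]
  rw [← this]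
  exact Real.exp_pos _

/-- The coefficients of Euler's expansion `(q x; q)_∞ = ∑ b_j x ^ j`. -/
def eulerCoeff (q : ℝ) (j : ℕ) : ℝ := ∏ i ∈ Finset.range j, (-(q ^ (i + 1) / (1 - q ^ (i + 1))))

theorem eulerCoeff_zero : eulerCoeff q 0 = 1 := by simp [eulerCoeff]

theorem one_sub_pow_succ_pos (hq0 : 0 < q) (hq1 : q < 1) (j : ℕ) : 0 < 1 - q ^ (j + 1) := by
  have := pow_lt_one₀ hq0.le hq1 (Nat.add_one_ne_zero j)
  linarith

theorem eulerCoeff_succ (hq0 : 0 < q) (hq1 : q < 1) (j : ℕ) :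
    (1 - q ^ (j + 1)) * eulerCoeff q (j + 1) = -(q ^ (j + 1) * eulerCoeff q j) := by
  have := one_sub_pow_succ_pos hq0 hq1 j
  rw [eulerCoeff, Finset.prod_range_succ, ← eulerCoeff]
  field_simp

theorem eulerCoeff_ne_zero (hq0 : 0 < q) (hq1 : q < 1) (j : ℕ) : eulerCoeff q j ≠ 0 := by
  refine Finset.prod_ne_zero_iff.2 fun i _ => ?_
  have := one_sub_pow_succ_pos hq0 hq1 i
  have := pow_pos hq0 (i + 1)
  exact neg_ne_zero.2 (by positivity)

/-- The ratio of consecutive coefficients is of size `q^(n+1)`, so the expansion is entire.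
Convergence at `x = q^(-α) > 1` is needed in the eigenvalue equation. -/
theorem summable_eulerCoeff_mul_pow (hq0 : 0 < q) (hq1 : q < 1) (x : ℝ) :
    Summable fun j => eulerCoeff q j * x ^ j := by
  rcases eq_or_ne x 0 with rfl | hx
  · refine summable_of_ne_finset_zero (s := {0}) fun j hj => ?_
    simp at hj
    simp [hj]
  refine summable_of_ratio_test_tendsto_lt_one (l := 0) zero_lt_one
    (Eventually.of_forall fun j => mul_ne_zero (eulerCoeff_ne_zero hq0 hq1 j) (pow_ne_zero _ hx)) ?_
  have h0 : Tendsto (fun n : ℕ => q ^ (n + 1)) atTop (𝓝 0) :=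
    (tendsto_pow_atTop_nhds_zero_of_lt_one hq0.le hq1).comp (tendsto_add_atTop_nat 1)
  have h1 : Tendsto (fun n : ℕ => q ^ (n + 1) / (1 - q ^ (n + 1)) * |x|) atTop (𝓝 0) := by
    simpa using (h0.div (h0.const_sub 1) (by norm_num)).mul_const |x|
  refine h1.congr fun n => ?_
  have hb := eulerCoeff_ne_zero hq0 hq1 n
  have hp := one_sub_pow_succ_pos hq0 hq1 n
  have hqn := pow_pos hq0 (n + 1)
  have hs : eulerCoeff q (n + 1) = -(q ^ (n + 1) / (1 - q ^ (n + 1)) * eulerCoeff q n) := by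
    have := eulerCoeff_succ hq0 hq1 n
    field_simp
    linarith
  rw [hs, pow_succ x, Real.norm_eq_abs, Real.norm_eq_abs, abs_mul, abs_neg, abs_mul, abs_mul,
    abs_mul, abs_of_pos (div_pos hqn hp)]
  have : |eulerCoeff q n| ≠ 0 := abs_ne_zero.2 hb
  have : |x ^ n| ≠ 0 := abs_ne_zero.2 (pow_ne_zero _ hx)
  field_simp

theorem summable_eulerCoeff_mul_pow_norm (hq0 : 0 < q) (hq1 : q < 1) (x : ℝ) :
    Summable fun j => |eulerCoeff q j| * |x| ^ j := by
  simpa [abs_mul] using (summable_eulerCoeff_mul_pow hq0 hq1 x).abs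

theorem summable_eulerCoeff (hq0 : 0 < q) (hq1 : q < 1) : Summable fun j => |eulerCoeff q j| := by
  simpa using summable_eulerCoeff_mul_pow_norm hq0 hq1 1

/-- The recursion `eulerCoeff_succ` is exactly this functional equation read coefficient by
coefficient. -/
theorem tsum_eulerCoeff_functional (hq0 : 0 < q) (hq1 : q < 1) (x : ℝ) :
    ∑' j, eulerCoeff q j * x ^ j = (1 - q * x) * ∑' j, eulerCoeff q j * (q * x) ^ j := by
  have h1 := summable_eulerCoeff_mul_pow hq0 hq1 x
  have h2 := summable_eulerCoeff_mul_pow hq0 hq1 (q * x)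
  have h1' := (summable_nat_add_iff 1).2 h1
  have h2' := (summable_nat_add_iff 1).2 h2
  have h3 : ∑' j, eulerCoeff q (j + 1) * x ^ (j + 1) =
      ∑' j, eulerCoeff q (j + 1) * (q * x) ^ (j + 1) -
        q * x * ∑' j, eulerCoeff q j * (q * x) ^ j := by
    rw [← tsum_mul_left, ← h2'.tsum_sub (h2.mul_left _)]
    refine tsum_congr fun j => ?_
    have := eulerCoeff_succ hq0 hq1 j
    rw [mul_pow, mul_pow, pow_succ x]
    rw [pow_succ q] at this ⊢
    linear_combination x ^ j * x * this
  rw [sub_mul, one_mul, h1.tsum_eq_zero_add, h3]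
  conv_rhs => rw [h2.tsum_eq_zero_add]
  rw [h2.tsum_eq_zero_add]
  simp
  ring

/-- Euler's expansion of the infinite `q`-shifted factorial. -/
theorem qPochInf_mul_eq_tsum (hq0 : 0 < q) (hq1 : q < 1) (x : ℝ) :
    qPochInf q (q * x) = ∑' j, eulerCoeff q j * x ^ j := by
  set G : ℝ → ℝ := fun y => ∑' j, eulerCoeff q j * y ^ j with hG
  -- Iterating the functional equation produces the finite products; the remaining factor tends to
  -- `G 0 = 1`.
  have hiter : ∀ N : ℕ, G x = (∏ k ∈ Finset.range N, (1 - q ^ k * (q * x))) * G (q ^ N * x) := by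
    intro N
    induction N with
    | zero => simp
    | succ N ih =>
      rw [ih, Finset.prod_range_succ, mul_assoc]
      congr 1
      have := tsum_eulerCoeff_functional hq0 hq1 (q ^ N * x)
      simp only [hG]
      rw [this]
      have h1 : q * (q ^ N * x) = q ^ (N + 1) * x := by ring
      have h2 : q ^ N * (q * x) = q ^ (N + 1) * x := by ring
      rw [h1, h2]
  have hcont : ContinuousOn G (Metric.closedBall 0 |x|) := by
    refine continuousOn_tsum (fun j => by fun_prop)
      (summable_eulerCoeff_mul_pow_norm hq0 hq1 x) fun j y hy => ?_
    rw [Metric.mem_closedBall, dist_zero_right, Real.norm_eq_abs] at hy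
    rw [Real.norm_eq_abs, abs_mul, abs_pow]
    gcongr
  have hG0 : G 0 = 1 := by
    simp only [hG]
    rw [tsum_eq_single 0 (fun j hj => by simp [hj])]
    simp [eulerCoeff_zero]
  have hlim : Tendsto (fun N : ℕ => q ^ N * x) atTop (𝓝[Metric.closedBall 0 |x|] 0) := by
    refine tendsto_nhdsWithin_iff.2 ⟨?_, Eventually.of_forall fun N => ?_⟩
    · simpa using (tendsto_pow_atTop_nhds_zero_of_lt_one hq0.le hq1).mul_const x
    · rw [Metric.mem_closedBall, dist_zero_right, Real.norm_eq_abs, abs_mul,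
        abs_of_pos (pow_pos hq0 N)]
      exact mul_le_of_le_one_left (abs_nonneg x) (pow_le_one₀ hq0.le hq1.le)
  have h1 : Tendsto (fun N : ℕ => G (q ^ N * x)) atTop (𝓝 1) := by
    rw [← hG0]
    exact (hcont 0 (by simp)).tendsto.comp hlim
  have h2 := ((multipliable_qPochInf hq0 hq1 (q * x)).hasProd.tendsto_prod_nat).mul h1
  have h3 : Tendsto (fun _ : ℕ => G x) atTop (𝓝 (G x)) := tendsto_const_nhds
  have := tendsto_nhds_unique h3 (h2.congr fun N => (hiter N).symm)
  rw [mul_one] at this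
  exact this.symm

end QPoch

/-! ### Partial fractions of the `q`-Mittag-Leffler function -/

section PartialFractions

variable {q p : ℝ}

/-- The partial fraction series `(q; q)_∞⁻¹ ∑ b_j / (1 - w p ^ j)`, which for `p = q ^ α` represents
the `q`-Mittag-Leffler function `e_{α, 1}` at `z = w (1 - q) ^ (-α)`. -/
def mlSeries (q p w : ℝ) : ℝ :=
  (qPochInf q q)⁻¹ * ∑' j : ℕ, eulerCoeff q j / (1 - w * p ^ j)

theorem one_le_one_sub_mul_pow (hp0 : 0 < p) {w : ℝ} (hw : w ≤ 0) (j : ℕ) :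
    1 ≤ 1 - w * p ^ j := by
  have := pow_pos hp0 j
  nlinarith

theorem summable_eulerCoeff_div (hq0 : 0 < q) (hq1 : q < 1) (hp0 : 0 < p) {w : ℝ} (hw : w ≤ 0) :
    Summable fun j : ℕ => eulerCoeff q j / (1 - w * p ^ j) := by
  refine Summable.of_norm_bounded (summable_eulerCoeff hq0 hq1) fun j => ?_
  have h := one_le_one_sub_mul_pow hp0 hw j
  rw [Real.norm_eq_abs, abs_div, abs_of_pos (by linarith : 0 < 1 - w * p ^ j)]
  exact div_le_self (abs_nonneg _) h

theorem mlSeries_zero (hq0 : 0 < q) (hq1 : q < 1) : mlSeries q p 0 = 1 := by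
  have h := qPochInf_mul_eq_tsum hq0 hq1 1
  simp only [mul_one, one_pow] at h
  simp only [mlSeries, zero_mul, sub_zero, div_one, ← h]
  exact inv_mul_cancel₀ (qPochInf_pos hq0 hq1 hq1).ne'

/-- Both denominators are at least `1`. The exponents are independent because the bound serves both
for two arguments at equal exponents and for one argument at consecutive exponents. -/
theorem abs_inv_one_sub_sub_le (hp0 : 0 < p) {w w' : ℝ} (hw : w ≤ 0) (hw' : w' ≤ 0) (i j : ℕ) :
    |(1 - w * p ^ i)⁻¹ - (1 - w' * p ^ j)⁻¹| ≤ |w * p ^ i - w' * p ^ j| := by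
  have h := one_le_one_sub_mul_pow hp0 hw i
  have h' := one_le_one_sub_mul_pow hp0 hw' j
  rw [inv_sub_inv (by linarith) (by linarith), abs_div,
    abs_of_pos (by nlinarith : 0 < (1 - w * p ^ i) * (1 - w' * p ^ j))]
  rw [show 1 - w' * p ^ j - (1 - w * p ^ i) = w * p ^ i - w' * p ^ j by ring]
  exact div_le_self (abs_nonneg _) (by nlinarith)

/-- A Lipschitz constant of `mlSeries` on the negative half-line. -/
def mlLip (q : ℝ) : ℝ := (qPochInf q q)⁻¹ * ∑' j : ℕ, |eulerCoeff q j|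

theorem mlLip_nonneg (hq0 : 0 < q) (hq1 : q < 1) : 0 ≤ mlLip q :=
  mul_nonneg (inv_nonneg.2 (qPochInf_pos hq0 hq1 hq1).le) (tsum_nonneg fun _ => abs_nonneg _)

theorem abs_mlSeries_sub_le (hq0 : 0 < q) (hq1 : q < 1) (hp0 : 0 < p) (hp1 : p < 1) {w w' : ℝ}
    (hw : w ≤ 0) (hw' : w' ≤ 0) :
    |mlSeries q p w - mlSeries q p w'| ≤ mlLip q * |w - w'| := by
  have hP := qPochInf_pos hq0 hq1 hq1
  rw [mlSeries, mlSeries, ← mul_sub, abs_mul, abs_of_pos (inv_pos.2 hP), mlLip, mul_assoc,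
    ← (summable_eulerCoeff_div hq0 hq1 hp0 hw).tsum_sub (summable_eulerCoeff_div hq0 hq1 hp0 hw'),
    ← tsum_mul_right]
  refine mul_le_mul_of_nonneg_left ?_ (inv_pos.2 hP).le
  rw [← Real.norm_eq_abs]
  refine tsum_of_norm_bounded (((summable_eulerCoeff hq0 hq1).mul_right _).hasSum) fun j => ?_
  rw [div_eq_mul_inv, div_eq_mul_inv, ← mul_sub, Real.norm_eq_abs, abs_mul]
  refine mul_le_mul_of_nonneg_left ((abs_inv_one_sub_sub_le hp0 hw hw' j j).trans ?_)
    (abs_nonneg _)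
  rw [← sub_mul, abs_mul, abs_of_pos (pow_pos hp0 j)]
  exact mul_le_of_le_one_right (abs_nonneg _) (pow_le_one₀ hp0.le hp1.le)

/-- The complexified series converges normally on a half-plane `Re z < r < 1`, where `|1 - z p^j| ≥
1 - r`; the real part of its holomorphic sum restricts to a real-analytic function on the axis. -/
theorem analyticAt_mlSeries (hq0 : 0 < q) (hq1 : q < 1) (hp0 : 0 < p) (hp1 : p < 1) {w : ℝ}
    (hw : w < 1) : AnalyticAt ℝ (mlSeries q p) w := by
  -- `r` is also kept above `0`, so that `Re z < r` still gives `Re z * p^j < r` after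
  -- multiplication by `p^j ≤ 1`.
  obtain ⟨r, hr, hr1⟩ := exists_between (max_lt hw zero_lt_one)
  obtain ⟨hwr, hr0⟩ := max_lt_iff.1 hr
  set U : Set ℂ := {z | z.re < r} with hU
  have hUo : IsOpen U := isOpen_lt Complex.continuous_re continuous_const
  have hbd : ∀ (j : ℕ) (z : ℂ), z ∈ U → 1 - r ≤ ‖1 - z * (p : ℂ) ^ j‖ := by
    intro j z hz
    have h1 : (1 - z * (p : ℂ) ^ j).re = 1 - z.re * p ^ j := by
      rw [← Complex.ofReal_pow, Complex.sub_re, Complex.re_mul_ofReal, Complex.one_re]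
    refine le_trans ?_ (Complex.re_le_norm _)
    rw [h1]
    have h2 := pow_pos hp0 j
    have h3 : p ^ j ≤ 1 := pow_le_one₀ hp0.le hp1.le
    have hz' : z.re < r := hz
    nlinarith
  have hd : DifferentiableOn ℂ
      (fun z : ℂ => ∑' j : ℕ, (eulerCoeff q j : ℂ) / (1 - z * (p : ℂ) ^ j)) U := by
    refine Complex.differentiableOn_tsum_of_summable_norm
      ((summable_eulerCoeff hq0 hq1).mul_right (1 - r)⁻¹) (fun j => ?_) hUo fun j z hz => ?_
    · refine DifferentiableOn.div (by fun_prop) (by fun_prop) fun z hz h0 => ?_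
      have := hbd j z hz
      rw [h0, norm_zero] at this
      linarith
    · rw [norm_div, Complex.norm_real, Real.norm_eq_abs, div_eq_mul_inv]
      gcongr
      exact hbd j z hz
  have ha : AnalyticAt ℂ
      (fun z : ℂ => ∑' j : ℕ, (eulerCoeff q j : ℂ) / (1 - z * (p : ℂ) ^ j)) (w : ℂ) :=
    hd.analyticAt (hUo.mem_nhds (by simpa [hU] using hwr))
  have hre := ha.re_ofReal
  have heq : mlSeries q p = fun x : ℝ => (qPochInf q q)⁻¹ *
      (∑' j : ℕ, (eulerCoeff q j : ℂ) / (1 - (x : ℂ) * (p : ℂ) ^ j)).re := by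
    funext x
    rw [mlSeries]
    congr 1
    rw [← Complex.ofReal_re (∑' j : ℕ, eulerCoeff q j / (1 - x * p ^ j)), Complex.ofReal_tsum]
    congr 1
    refine tsum_congr fun j => ?_
    push_cast
    rfl
  rw [heq]
  exact analyticAt_const.mul hre

/-- The power series of `mlSeries` at the origin. -/
theorem hasSum_mlSeries (hq0 : 0 < q) (hq1 : q < 1) (hp0 : 0 < p) (hp1 : p < 1) {w : ℝ}
    (hw : |w| < 1) :
    HasSum (fun k : ℕ => w ^ k * (qPochInf q (q * p ^ k) / qPochInf q q)) (mlSeries q p w) := by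
  -- Absolute convergence allows summing in either order: geometric series in `k`, Euler's expansion
  -- at `p^k` in `j`.
  have hs : Summable fun x : ℕ × ℕ => eulerCoeff q x.1 * (w * p ^ x.1) ^ x.2 := by
    have h0 : Summable fun x : ℕ × ℕ => |eulerCoeff q x.1| * |w| ^ x.2 :=
      (summable_eulerCoeff hq0 hq1).mul_of_nonneg
        (summable_geometric_of_lt_one (abs_nonneg w) hw) (fun _ => abs_nonneg _)
        (fun _ => by positivity)
    refine Summable.of_norm_bounded h0 fun x => ?_
    rw [Real.norm_eq_abs, abs_mul, abs_pow, abs_mul, abs_of_pos (pow_pos hp0 _)]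
    gcongr
    exact mul_le_of_le_one_right (abs_nonneg _) (pow_le_one₀ hp0.le hp1.le)
  have h1 : ∀ j : ℕ, HasSum (fun k : ℕ => eulerCoeff q j * (w * p ^ j) ^ k)
      (eulerCoeff q j / (1 - w * p ^ j)) := by
    intro j
    rw [div_eq_mul_inv]
    refine (hasSum_geometric_of_abs_lt_one ?_).mul_left _
    rw [abs_mul, abs_of_pos (pow_pos hp0 j)]
    exact lt_of_le_of_lt
      (mul_le_of_le_one_right (abs_nonneg _) (pow_le_one₀ hp0.le hp1.le)) hw
  have h2 : ∀ k : ℕ, HasSum (fun j : ℕ => eulerCoeff q j * (w * p ^ j) ^ k)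
      (w ^ k * qPochInf q (q * p ^ k)) := by
    intro k
    rw [qPochInf_mul_eq_tsum hq0 hq1]
    refine ((summable_eulerCoeff_mul_pow hq0 hq1 (p ^ k)).hasSum.mul_left (w ^ k)).congr_fun ?_
    intro j
    ring
  have h3 := hs.hasSum.prod_fiberwise h1
  have h4 := ((Equiv.prodComm ℕ ℕ).hasSum_iff.2 hs.hasSum).prod_fiberwise h2
  rw [mlSeries, h3.tsum_eq, mul_comm]
  refine (h4.mul_right (qPochInf q q)⁻¹).congr_fun fun k => ?_
  rw [div_eq_mul_inv, mul_assoc]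

end PartialFractions

/-! ### Identification of the Mittag-Leffler function with its partial fractions -/

section MittagLeffler

variable {q α : ℝ}

/-- With `p = q^α`, `1 / Γ_q(α k + 1) = (q p^k; q)_∞ (1-q)^(α k) / (q; q)_∞`, hence the rescaling of
`z`. The poles `w = p^(-j)` are all at least `1`, outside the half-line. -/
theorem isQMittagLeffler_mlSeries (hq0 : 0 < q) (hq1 : q < 1) (hα : 0 < α) :
    IsQMittagLeffler q α 1 fun z => mlSeries q (q ^ α) (z * (1 - q) ^ α) := by
  have hp0 : 0 < q ^ α := Real.rpow_pos_of_pos hq0 α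
  have hp1 : q ^ α < 1 := Real.rpow_lt_one hq0.le hq1 hα
  have h1q : 0 < 1 - q := by linarith
  have hc : 0 < (1 - q) ^ α := Real.rpow_pos_of_pos h1q α
  constructor
  · intro z hz
    refine (hasSum_mlSeries hq0 hq1 hp0 hp1 hz).congr_fun fun k => ?_
    have e1 : q ^ (α * k + 1) = q * (q ^ α) ^ k := by
      rw [Real.rpow_add hq0, Real.rpow_one, Real.rpow_mul_natCast hq0.le, mul_comm]
    have e2 : (1 - q) ^ (1 - (α * k + 1)) = (((1 - q) ^ α) ^ k)⁻¹ := by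
      rw [← Real.rpow_mul_natCast h1q.le, ← Real.rpow_neg h1q.le]
      congr 1
      ring
    have e3 : q * (q ^ α) ^ k < 1 := by
      have : (q ^ α) ^ k ≤ 1 := pow_le_one₀ hp0.le hp1.le
      nlinarith
    have := qPochInf_pos hq0 hq1 e3
    have := qPochInf_pos hq0 hq1 hq1
    rw [qGamma, e1, e2, mul_pow]
    field_simp
  · intro z hz
    have hz' : z * (1 - q) ^ α < 1 := by
      rw [mem_Iio, Real.rpow_neg h1q.le] at hz
      rwa [← lt_div_iff₀ hc, one_div]
    exact (analyticAt_mlSeries hq0 hq1 hp0 hp1 hz').comp_of_eq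
      (f := fun z : ℝ => z * (1 - q) ^ α) (by fun_prop) rfl

theorem qMittagLeffler_eq_mlSeries (hq0 : 0 < q) (hq1 : q < 1) (hα : 0 < α) {z : ℝ} (hz : z ≤ 0) :
    qMittagLeffler q α 1 z = mlSeries q (q ^ α) (z * (1 - q) ^ α) :=
  (isQMittagLeffler_mlSeries hq0 hq1 hα).qMittagLeffler_eqOn hq1
    (hz.trans_lt (Real.rpow_pos_of_pos (by linarith) _))

end MittagLeffler

/-! ### The Caputo kernel on the `q`-lattice -/

section Kernel

variable {q α p : ℝ}

/-- The values `(q ^ (n + 1); q)_∞ / (q ^ (n + 1 - α); q)_∞` of the Caputo kernel. -/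
def latticeKernel (q α : ℝ) (n : ℕ) : ℝ :=
  qPochInf q (q ^ (n + 1)) / qPochInf q (q ^ (-α) * q ^ (n + 1))

theorem rpow_neg_mul_pow_succ_lt_one (hq0 : 0 < q) (hq1 : q < 1) (hα1 : α < 1) (n : ℕ) :
    q ^ (-α) * q ^ (n + 1) < 1 := by
  rw [← Real.rpow_natCast, ← Real.rpow_add hq0]
  refine Real.rpow_lt_one hq0.le hq1 ?_
  push_cast
  have : (0 : ℝ) ≤ n := n.cast_nonneg
  linarith

theorem latticeKernel_pos (hq0 : 0 < q) (hq1 : q < 1) (hα1 : α < 1) (n : ℕ) :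
    0 < latticeKernel q α n :=
  div_pos (qPochInf_pos hq0 hq1 (pow_lt_one₀ hq0.le hq1 (Nat.add_one_ne_zero n)))
    (qPochInf_pos hq0 hq1 (rpow_neg_mul_pow_succ_lt_one hq0 hq1 hα1 n))

/-- Peeling the first factor off both products. Monotonicity and the functional equation of the
generating series both come from this recursion. -/
theorem latticeKernel_succ (hq0 : 0 < q) (hq1 : q < 1) (hα1 : α < 1) (n : ℕ) :
    (1 - q ^ (n + 1)) * latticeKernel q α (n + 1) =
      (1 - q ^ (-α) * q ^ (n + 1)) * latticeKernel q α n := by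
  have h1 := qPochInf_eq_mul hq0 hq1 (q ^ (n + 1))
  have h2 := qPochInf_eq_mul hq0 hq1 (q ^ (-α) * q ^ (n + 1))
  rw [← pow_succ'] at h1
  rw [show q * (q ^ (-α) * q ^ (n + 1)) = q ^ (-α) * q ^ (n + 1 + 1) by ring] at h2
  have h3 := qPochInf_pos hq0 hq1 (rpow_neg_mul_pow_succ_lt_one hq0 hq1 hα1 (n + 1))
  have h4 := rpow_neg_mul_pow_succ_lt_one hq0 hq1 hα1 n
  have h5 : 1 - q ^ (-α) * q ^ (n + 1) ≠ 0 := by linarith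
  rw [latticeKernel, latticeKernel, h1, h2]
  generalize qPochInf q (q ^ (-α) * q ^ (n + 1 + 1)) = P at h3
  generalize 1 - q ^ (-α) * q ^ (n + 1) = D at h5
  field_simp

theorem latticeKernel_antitone (hq0 : 0 < q) (hq1 : q < 1) (hα0 : 0 < α) (hα1 : α < 1) :
    Antitone (latticeKernel q α) := by
  refine antitone_nat_of_succ_le fun n => ?_
  have h1 := latticeKernel_succ hq0 hq1 hα1 n
  have h2 := latticeKernel_pos hq0 hq1 hα1 n
  have h3 := one_sub_pow_succ_pos hq0 hq1 n
  have h4 : 1 ≤ q ^ (-α) := Real.one_le_rpow_of_pos_of_le_one_of_nonpos hq0 hq1.le (by linarith)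
  have h5 : q ^ (n + 1) ≤ q ^ (-α) * q ^ (n + 1) := le_mul_of_one_le_left (pow_pos hq0 _).le h4
  refine le_of_mul_le_mul_left ?_ h3
  rw [h1]
  exact mul_le_mul_of_nonneg_right (by linarith) h2.le

/-- Turns the factor `K_0 w` of the lattice eigenvalue equation, at `w = -μ t^α (1-q)^α`, into `-μ
t^α Γ_q(1-α)`. -/
theorem latticeKernel_zero_mul_rpow (hq0 : 0 < q) :
    latticeKernel q α 0 * (1 - q) ^ α = qGamma q (1 - α) := by
  rw [latticeKernel, qGamma, zero_add, pow_one, sub_sub_cancel, ← Real.rpow_add_one hq0.ne',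
    neg_add_eq_sub]

theorem qGamma_one_sub_pos (hq0 : 0 < q) (hq1 : q < 1) (hα1 : α < 1) : 0 < qGamma q (1 - α) := by
  rw [← latticeKernel_zero_mul_rpow hq0]
  exact mul_pos (latticeKernel_pos hq0 hq1 hα1 0) (Real.rpow_pos_of_pos (by linarith) _)

open PowerSeries in
/-- The Cauchy product of the kernel with Euler's coefficients. -/
theorem sum_antidiagonal_latticeKernel_eulerCoeff (hq0 : 0 < q) (hq1 : q < 1) (hα1 : α < 1)
    (N : ℕ) :
    ∑ x ∈ Finset.HasAntidiagonal.antidiagonal N, latticeKernel q α x.1 * eulerCoeff q x.2 =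
      latticeKernel q α 0 * ∑ i ∈ Finset.range (N + 1), eulerCoeff q i * (q ^ (-α)) ^ i := by
  set A : PowerSeries ℝ := PowerSeries.mk (latticeKernel q α) with hA
  set B : PowerSeries ℝ := PowerSeries.mk (eulerCoeff q) with hB
  set a := q ^ (-α) with ha
  -- The recursions of the kernel and of Euler's coefficients, as `q`-difference equations for their
  -- generating series.
  have hAe : (1 - X) * A = (1 - C (a * q) * X) * rescale q A := by
    ext n
    rcases n with _ | n
    · simp only [sub_mul, mul_assoc, one_mul, map_sub, coeff_zero_X_mul, coeff_C_mul,
        coeff_rescale, mul_zero, sub_zero, pow_zero]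
    · have := latticeKernel_succ hq0 hq1 hα1 n
      rw [sub_mul, sub_mul, one_mul, one_mul, mul_assoc]
      simp only [map_sub, coeff_succ_X_mul, coeff_C_mul, coeff_rescale, hA, coeff_mk]
      rw [pow_succ q] at this ⊢
      linear_combination this
  have hBe : B = (1 - C q * X) * rescale q B := by
    ext n
    rcases n with _ | n
    · simp only [sub_mul, mul_assoc, one_mul, map_sub, coeff_zero_X_mul, coeff_C_mul,
        coeff_rescale, mul_zero, sub_zero, pow_zero]
    · have := eulerCoeff_succ hq0 hq1 n
      rw [sub_mul, one_mul, mul_assoc]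
      simp only [map_sub, coeff_succ_X_mul, coeff_C_mul, coeff_rescale, hB, coeff_mk]
      rw [pow_succ q] at this ⊢
      linear_combination this
  -- This is the equation satisfied by `B(a X)`. It determines all coefficients from the constant
  -- term, so `(1 - X) A B = K_0 B(a X)`.
  have hM : (1 - X) * (A * B) = (1 - C (a * q) * X) * rescale q ((1 - X) * (A * B)) := by
    have hr : rescale q ((1 - X) * (A * B)) = (1 - C q * X) * (rescale q A * rescale q B) := by
      simp [rescale_X]
    rw [hr]
    calc (1 - X) * (A * B) = ((1 - X) * A) * B := by ring
      _ = ((1 - C (a * q) * X) * rescale q A) * ((1 - C q * X) * rescale q B) := by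
        rw [hAe, ← hBe]
      _ = _ := by ring
  have hcoef : ∀ n, coeff n ((1 - X) * (A * B)) =
      latticeKernel q α 0 * (eulerCoeff q n * a ^ n) := by
    intro n
    induction n with
    | zero => simp [hA, hB, sub_mul, eulerCoeff_zero]
    | succ n ih =>
      have h1 := congrArg (coeff (n + 1)) hM
      rw [sub_mul (1 : PowerSeries ℝ) (C (a * q) * X), one_mul, mul_assoc (C (a * q))] at h1
      simp only [map_sub (coeff (n + 1)), coeff_succ_X_mul, coeff_C_mul, coeff_rescale, ih] at h1
      have h2 := eulerCoeff_succ hq0 hq1 n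
      have h3 := one_sub_pow_succ_pos hq0 hq1 n
      refine mul_left_cancel₀ h3.ne' ?_
      have e : (1 - q ^ (n + 1)) * (latticeKernel q α 0 * (eulerCoeff q (n + 1) * a ^ (n + 1))) =
          latticeKernel q α 0 * a ^ (n + 1) * (-(q ^ (n + 1) * eulerCoeff q n)) := by
        rw [← h2]; ring
      rw [e, pow_succ q, pow_succ a]
      rw [pow_succ q] at h1
      linear_combination h1
  -- Division by `1 - X` replaces coefficients by their partial sums.
  have hD : ∀ n, coeff n (A * B) =
      latticeKernel q α 0 * ∑ i ∈ Finset.range (n + 1), eulerCoeff q i * a ^ i := by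
    intro n
    induction n with
    | zero => simp [hA, hB, eulerCoeff_zero]
    | succ n ih =>
      have h1 := hcoef (n + 1)
      rw [sub_mul, one_mul, map_sub, coeff_succ_X_mul, ih] at h1
      rw [Finset.sum_range_succ]
      linear_combination h1
  rw [← hD, coeff_mul]
  simp [hA, hB]

/-- The lattice form of the eigenvalue equation of the Caputo derivative for the Mittag-Leffler
function. -/
theorem hasSum_latticeKernel_mlSeries (hq0 : 0 < q) (hq1 : q < 1) (hα0 : 0 < α) (hα1 : α < 1)
    {w : ℝ} (hw : w ≤ 0) :
    HasSum (fun n : ℕ => latticeKernel q α n *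
        (mlSeries q (q ^ α) (w * (q ^ α) ^ n) - mlSeries q (q ^ α) (w * (q ^ α) ^ (n + 1))))
      (latticeKernel q α 0 * w * mlSeries q (q ^ α) w) := by
  have hp0 : 0 < q ^ α := Real.rpow_pos_of_pos hq0 α
  have hp1 : q ^ α < 1 := Real.rpow_lt_one hq0.le hq1 hα0
  have hpa : q ^ (-α) = (q ^ α)⁻¹ := Real.rpow_neg hq0.le α
  set p := q ^ α with hp
  set K := latticeKernel q α with hK
  have hKpos : ∀ n, 0 < K n := latticeKernel_pos hq0 hq1 hα1
  have hK0 : ∀ n, K n ≤ K 0 := fun n => latticeKernel_antitone hq0 hq1 hα0 hα1 (Nat.zero_le n)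
  -- Replacing `w` by `w p^n` only shifts the index of `g`, so the expanded sum depends on `g`
  -- through `n + j` alone and can be regrouped along antidiagonals.
  set g : ℕ → ℝ := fun j => (1 - w * p ^ j)⁻¹ with hg
  have hgd : ∀ n, |g n - g (n + 1)| ≤ |w| * p ^ n := by
    intro n
    refine (abs_inv_one_sub_sub_le hp0 hw hw n (n + 1)).trans ?_
    rw [← mul_sub, abs_mul]
    have := pow_pos hp0 n
    gcongr
    rw [pow_succ, abs_of_nonneg] <;> nlinarith
  have hg0 : Tendsto g atTop (𝓝 1) := by
    have h : Tendsto (fun j : ℕ => 1 - w * p ^ j) atTop (𝓝 1) := by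
      simpa using ((tendsto_pow_atTop_nhds_zero_of_lt_one hp0.le hp1).const_mul w).const_sub 1
    simpa using h.inv₀ one_ne_zero
  -- the double series over `ℕ × ℕ`
  set F : ℕ × ℕ → ℝ := fun x => K x.1 * eulerCoeff q x.2 * (g (x.1 + x.2) - g (x.1 + x.2 + 1))
    with hF
  -- The increments of `g` supply the geometric decay in `n`, and the Euler coefficients the decay
  -- in `j`.
  have hFs : Summable F := by
    have h0 : Summable fun x : ℕ × ℕ => p ^ x.1 * |eulerCoeff q x.2| :=
      (summable_geometric_of_lt_one hp0.le hp1).mul_of_nonneg (summable_eulerCoeff hq0 hq1)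
        (fun _ => by positivity) (fun _ => abs_nonneg _)
    refine Summable.of_norm_bounded (h0.mul_left (K 0 * |w|)) fun x => ?_
    simp only [hF]
    rw [Real.norm_eq_abs, abs_mul, abs_mul, abs_of_pos (hKpos _)]
    calc K x.1 * |eulerCoeff q x.2| * |g (x.1 + x.2) - g (x.1 + x.2 + 1)|
        ≤ K 0 * |eulerCoeff q x.2| * (|w| * p ^ x.1) := by
          have hk := hK0 x.1
          have hk0 := (hKpos 0).le
          gcongr
          exact (hgd _).trans (mul_le_mul_of_nonneg_left
            (pow_le_pow_of_le_one hp0.le hp1.le (Nat.le_add_right _ _)) (abs_nonneg w))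
      _ = _ := by ring
  have hrow : ∀ n, HasSum (fun j => F (n, j))
      (K n * (qPochInf q q * (mlSeries q p (w * p ^ n) - mlSeries q p (w * p ^ (n + 1))))) := by
    intro n
    have hwn : w * p ^ n ≤ 0 := mul_nonpos_of_nonpos_of_nonneg hw (pow_pos hp0 _).le
    have hwn' : w * p ^ (n + 1) ≤ 0 := mul_nonpos_of_nonpos_of_nonneg hw (pow_pos hp0 _).le
    have hP := (qPochInf_pos hq0 hq1 hq1).ne'
    have h := ((summable_eulerCoeff_div hq0 hq1 hp0 hwn).hasSum.sub
      (summable_eulerCoeff_div hq0 hq1 hp0 hwn').hasSum).mul_left (K n)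
    rw [mlSeries, mlSeries, ← mul_sub, mul_inv_cancel_left₀ hP]
    refine h.congr_fun fun j => ?_
    simp only [hF, hg, div_eq_mul_inv]
    ring_nf
  have hdiag : HasSum F (K 0 * w * (qPochInf q q * mlSeries q p w)) := by
    have h1 := (Finset.HasAntidiagonal.sigmaAntidiagonalEquivProd (A := ℕ)).hasSum_iff.2 hFs.hasSum
    have h2 := h1.sigma fun n => hasSum_fintype _
    have h3 : ∀ n, ∑ x : Finset.HasAntidiagonal.antidiagonal n,
        (F ∘ Finset.HasAntidiagonal.sigmaAntidiagonalEquivProd) ⟨n, x⟩ =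
        K 0 * (∑ i ∈ Finset.range (n + 1), eulerCoeff q i * (q ^ (-α)) ^ i) *
          (g n - g (n + 1)) := by
      intro n
      rw [← sum_antidiagonal_latticeKernel_eulerCoeff hq0 hq1 hα1, Finset.sum_mul,
        ← Finset.sum_coe_sort (Finset.HasAntidiagonal.antidiagonal n)]
      refine Finset.sum_congr rfl fun x _ => ?_
      have hx := Finset.HasAntidiagonal.mem_antidiagonal.1 x.2
      simp [hF, hx, hK]
    have h4 := h2.tendsto_sum_nat
    have hβ : Summable fun i => eulerCoeff q i * (q ^ (-α)) ^ i :=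
      summable_eulerCoeff_mul_pow hq0 hq1 _
    -- Summation by parts against `g - 1` instead of `g`, so that the boundary term vanishes as `g M
    -- → 1`.
    have habel : ∀ M : ℕ, ∑ n ∈ Finset.range M,
        K 0 * (∑ i ∈ Finset.range (n + 1), eulerCoeff q i * (q ^ (-α)) ^ i) * (g n - g (n + 1)) =
        K 0 * (∑ i ∈ Finset.range M, eulerCoeff q i * (q ^ (-α)) ^ i * (g i - 1) -
          (g M - 1) * ∑ i ∈ Finset.range M, eulerCoeff q i * (q ^ (-α)) ^ i) := by
      intro M
      induction M with
      | zero => simp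
      | succ M ih =>
        rw [Finset.sum_range_succ, ih, Finset.sum_range_succ, Finset.sum_range_succ]
        ring
    -- `g i - 1 = w p^i / (1 - w p^i)`, and `q^(-α i) = p^(-i)` cancels the power: the original
    -- partial fractions reappear, multiplied by `w`.
    have hterm : ∀ i, eulerCoeff q i * (q ^ (-α)) ^ i * (g i - 1) =
        w * (eulerCoeff q i / (1 - w * p ^ i)) := by
      intro i
      have h := one_le_one_sub_mul_pow hp0 hw i
      have h' : 1 - w * p ^ i ≠ 0 := by linarith
      have hpi : p ^ i ≠ 0 := (pow_pos hp0 i).ne'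
      simp only [hg, hpa, inv_pow]
      have e : w = (1 - (1 - w * p ^ i)) / p ^ i := by field_simp; ring
      generalize 1 - w * p ^ i = D at h' e ⊢
      rw [e]
      field_simp
    have hlim : Tendsto (fun M : ℕ => ∑ n ∈ Finset.range M,
        K 0 * (∑ i ∈ Finset.range (n + 1), eulerCoeff q i * (q ^ (-α)) ^ i) * (g n - g (n + 1)))
        atTop (𝓝 (K 0 * w * (qPochInf q q * mlSeries q p w))) := by
      simp only [habel, hterm]
      have t1 := ((summable_eulerCoeff_div hq0 hq1 hp0 hw).hasSum.mul_left w).tendsto_sum_nat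
      have t2 := (hg0.sub_const 1).mul hβ.hasSum.tendsto_sum_nat
      have t3 := (t1.sub t2).const_mul (K 0)
      have hP := (qPochInf_pos hq0 hq1 hq1).ne'
      rw [mlSeries, mul_inv_cancel_left₀ hP]
      simpa [mul_assoc] using t3
    have := tendsto_nhds_unique (h4.congr fun M => Finset.sum_congr rfl fun n _ => h3 n) hlim
    rw [← this]
    exact hFs.hasSum
  have h := (hdiag.prod_fiberwise hrow).mul_left (qPochInf q q)⁻¹
  have hP := (qPochInf_pos hq0 hq1 hq1).ne'
  have e : K 0 * w * mlSeries q p w =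
      (qPochInf q q)⁻¹ * (K 0 * w * (qPochInf q q * mlSeries q p w)) := by
    field_simp
  rw [e]
  exact h.congr_fun fun n => by field_simp

end Kernel

/-! ### A maximum principle on the lattice -/

section MaximumPrinciple

variable {𝕜 : Type*} [RCLike 𝕜] {K : ℕ → ℝ}

/-- By summation by parts the expression is `-∑ (K_j - K_{j+1}) a_{j+1}`, with nonnegative weights
that telescope. -/
theorem norm_sum_kernel_sub_le (hK : Antitone K) {a : ℕ → 𝕜} {M : ℝ}
    (hM : ∀ j, ‖a (j + 1)‖ ≤ M) (N : ℕ) :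
    ‖∑ j ∈ Finset.range N, (K j : 𝕜) * (a j - a (j + 1)) + (K N : 𝕜) * a N - (K 0 : 𝕜) * a 0‖ ≤
      (K 0 - K N) * M := by
  induction N with
  | zero => simp
  | succ N ih =>
    have hKN := hK (Nat.le_succ N)
    have e : ∑ j ∈ Finset.range (N + 1), (K j : 𝕜) * (a j - a (j + 1)) +
        (K (N + 1) : 𝕜) * a (N + 1) - (K 0 : 𝕜) * a 0 =
        (∑ j ∈ Finset.range N, (K j : 𝕜) * (a j - a (j + 1)) + (K N : 𝕜) * a N -
          (K 0 : 𝕜) * a 0) - ((K N - K (N + 1) : ℝ) : 𝕜) * a (N + 1) := by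
      rw [Finset.sum_range_succ]
      push_cast
      ring
    rw [e]
    refine (norm_sub_le _ _).trans ?_
    rw [norm_mul, RCLike.norm_ofReal, abs_of_nonneg (sub_nonneg.2 hKN)]
    have := mul_le_mul_of_nonneg_left (hM N) (sub_nonneg.2 hKN)
    linarith

theorem norm_le_of_hasSum_kernel (hK : Antitone K) (hK0 : ∀ n, 0 ≤ K n) {a : ℕ → 𝕜} {c M : ℝ}
    (hc : 0 ≤ c) (hM : ∀ j, ‖a (j + 1)‖ ≤ M)
    (h : HasSum (fun j => (K j : 𝕜) * (a j - a (j + 1))) (-(c : 𝕜) * a 0)) :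
    (K 0 + c) * ‖a 0‖ ≤ K 0 * M := by
  -- The range is `N + 1` because `M` bounds only the values of index at least `1`, so it must cover
  -- the boundary term `K_{N+1} a_{N+1}`.
  have h1 : ∀ N, ‖∑ j ∈ Finset.range (N + 1), (K j : 𝕜) * (a j - a (j + 1)) - (K 0 : 𝕜) * a 0‖ ≤
      K 0 * M := by
    intro N
    have e := norm_sum_kernel_sub_le hK hM (N + 1)
    have e2 : ‖(K (N + 1) : 𝕜) * a (N + 1)‖ ≤ K (N + 1) * M := by
      rw [norm_mul, RCLike.norm_ofReal, abs_of_nonneg (hK0 _)]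
      exact mul_le_mul_of_nonneg_left (hM N) (hK0 _)
    have e3 := norm_sub_le
      (∑ j ∈ Finset.range (N + 1), (K j : 𝕜) * (a j - a (j + 1)) + (K (N + 1) : 𝕜) * a (N + 1) -
        (K 0 : 𝕜) * a 0) ((K (N + 1) : 𝕜) * a (N + 1))
    rw [add_sub_right_comm, add_sub_cancel_right, ← add_sub_right_comm] at e3
    linarith
  have h2 := (((h.tendsto_sum_nat.comp (tendsto_add_atTop_nat 1)).sub_const
    ((K 0 : 𝕜) * a 0)).norm)
  have h3 := le_of_tendsto' h2 h1
  have e : -(c : 𝕜) * a 0 - (K 0 : 𝕜) * a 0 = -(((K 0 + c : ℝ) : 𝕜) * a 0) := by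
    push_cast; ring
  rwa [e, norm_neg, norm_mul, RCLike.norm_ofReal, abs_of_nonneg (add_nonneg (hK0 0) hc)] at h3

/-- The maximum principle: a solution of the homogeneous lattice equation is bounded by its
limit. -/
theorem norm_le_norm_limit_of_kernel (hK : Antitone K) (hK0 : ∀ n, 0 < K n) {a : ℕ → 𝕜} {ℓ : 𝕜}
    {c : ℕ → ℝ} (hc : ∀ n, 0 ≤ c n) (ha : Tendsto a atTop (𝓝 ℓ))
    (h : ∀ n, HasSum (fun j => (K j : 𝕜) * (a (n + j) - a (n + j + 1))) (-(c n : 𝕜) * a n)) :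
    (K 0 + c 0) * ‖a 0‖ ≤ K 0 * ‖ℓ‖ := by
  have key : ∀ ε > 0, ∀ n, ‖a n‖ ≤ ‖ℓ‖ + ε := by
    intro ε hε
    obtain ⟨N, hN⟩ := eventually_atTop.1
      (ha.norm.eventually_le_const (lt_add_of_pos_right ‖ℓ‖ hε))
    -- Descending induction: the bound holds from `N` on by convergence, and each earlier value is
    -- dominated by the later ones.
    have hdown : ∀ k, ∀ n, N ≤ n + k → ‖a n‖ ≤ ‖ℓ‖ + ε := by
      intro k
      induction k with
      | zero => exact fun n hn => hN n hn
      | succ k ih =>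
        intro n hn
        by_cases hn' : N ≤ n + k
        · exact ih n hn'
        have hj : ∀ j, ‖a (n + (j + 1))‖ ≤ ‖ℓ‖ + ε := fun j => ih _ (by omega)
        have := norm_le_of_hasSum_kernel (a := fun j => a (n + j)) hK (fun n => (hK0 n).le) (hc n)
          hj (h n)
        simp only [add_zero] at this
        have h1 : K 0 * ‖a n‖ ≤ K 0 * (‖ℓ‖ + ε) := by
          have := mul_nonneg (hc n) (norm_nonneg (a n))
          linarith
        exact le_of_mul_le_mul_left h1 (hK0 0)
    exact fun n => hdown N n (Nat.le_add_left N n)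
  have hle : ∀ n, ‖a n‖ ≤ ‖ℓ‖ := fun n => le_of_forall_pos_le_add fun ε hε => key ε hε n
  -- One more application at index `0`, now with the sharp bound and keeping the gain `c 0`.
  refine norm_le_of_hasSum_kernel hK (fun n => (hK0 n).le) (hc 0) (fun j => hle _) ?_
  simpa using h 0

end MaximumPrinciple

/-! ### The Caputo derivative on the lattice -/

section Caputo

variable {𝕜 : Type*} [RCLike 𝕜] {E : Type*} [AddCommGroup E] [Module 𝕜 E] {q α t : ℝ}

theorem natCeil_eq_one (hα0 : 0 < α) (hα1 : α < 1) : ⌈α⌉₊ = 1 := by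
  rw [Nat.ceil_eq_iff one_ne_zero]
  simpa using ⟨hα0, hα1.le⟩

/-- The lattice increments weighted by the Caputo kernel. -/
def kernelTerm (𝕜 : Type*) [RCLike 𝕜] {E : Type*} [AddCommGroup E] [Module 𝕜 E] (q α : ℝ)
    (u : ℝ → E) (t : ℝ) (n : ℕ) : E :=
  ((latticeKernel q α n : ℝ) : 𝕜) • (u (t * q ^ n) - u (t * q ^ (n + 1)))

/-- The Jackson weight `q^n` cancels against the step `t q^n (1 - q)` in the `q`-derivative. -/
theorem caputoTerm_eq_smul_kernelTerm (hq0 : 0 < q) (hα0 : 0 < α) (hα1 : α < 1) (ht : 0 < t)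
    (u : ℝ → E) (n : ℕ) :
    caputoTerm 𝕜 q α u t n =
      ((t ^ (-α) / (t * (1 - q)) : ℝ) : 𝕜) • kernelTerm 𝕜 q α u t n := by
  have e1 : qKernel q ((⌈α⌉₊ : ℝ) - α) t (t * q ^ n) = t ^ (-α) * latticeKernel q α n := by
    rw [natCeil_eq_one hα0 hα1, qKernel, latticeKernel, Nat.cast_one]
    have e2 : q * (t * q ^ n) / t = q ^ (n + 1) := by
      field_simp
      rw [pow_succ']
    have e3 : (1 : ℝ) - α - 1 = -α := by ring
    rw [e2, e3]
  have e4 : q * (t * q ^ n) = t * q ^ (n + 1) := by ring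
  rw [caputoTerm, jacksonTerm, rlIntegrand, e1, natCeil_eq_one hα0 hα1, Function.iterate_one,
    qDeriv, kernelTerm, e4, smul_smul, smul_smul, smul_smul]
  congr 1
  have hqn := (pow_pos hq0 n).ne'
  norm_cast
  field_simp

variable [TopologicalSpace E]

theorem caputo_eq_smul_tsum_caputoTerm (hα0 : 0 < α) (hα1 : α < 1) (u : ℝ → E) :
    caputo 𝕜 q α u t = (((qGamma q (1 - α))⁻¹ : ℝ) : 𝕜) • (((1 - q) * t : ℝ) : 𝕜) •
      ∑' n, caputoTerm 𝕜 q α u t n := by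
  have e : ((⌈α⌉₊ : ℝ) - α) = 1 - α := by rw [natCeil_eq_one hα0 hα1, Nat.cast_one]
  rw [caputo, rlIntegral, jacksonIntegral]
  simp only [caputoTerm, e]

variable [ContinuousConstSMul 𝕜 E]

/-- The two families differ by a nonzero scalar. Only a topological module is assumed, so that this
serves both for formal series and in `H`. -/
theorem summable_caputoTerm_iff (hq0 : 0 < q) (hq1 : q < 1) (hα0 : 0 < α) (hα1 : α < 1)
    (ht : 0 < t) (u : ℝ → E) :
    Summable (caputoTerm 𝕜 q α u t) ↔ Summable (kernelTerm 𝕜 q α u t) := by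
  have h1q : 0 < 1 - q := by linarith
  have hne : ((t ^ (-α) / (t * (1 - q)) : ℝ) : 𝕜) ≠ 0 :=
    RCLike.ofReal_ne_zero.2 (div_pos (Real.rpow_pos_of_pos ht _) (by positivity)).ne'
  have e : caputoTerm 𝕜 q α u t =
      fun n => ((t ^ (-α) / (t * (1 - q)) : ℝ) : 𝕜) • kernelTerm 𝕜 q α u t n :=
    funext (caputoTerm_eq_smul_kernelTerm hq0 hα0 hα1 ht u)
  rw [e]
  refine ⟨fun h => ?_, fun h => h.const_smul _⟩
  simpa only [inv_smul_smul₀ hne] using h.const_smul (((t ^ (-α) / (t * (1 - q)) : ℝ) : 𝕜)⁻¹)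

theorem caputo_eq_of_hasSum [T2Space E] (hq0 : 0 < q) (hq1 : q < 1) (hα0 : 0 < α) (hα1 : α < 1)
    (ht : 0 < t) {u : ℝ → E} {s : E} (h : HasSum (kernelTerm 𝕜 q α u t) s) :
    caputo 𝕜 q α u t = ((t ^ (-α) / qGamma q (1 - α) : ℝ) : 𝕜) • s := by
  have h1q : 0 < 1 - q := by linarith
  have h1 := h.const_smul ((t ^ (-α) / (t * (1 - q)) : ℝ) : 𝕜)
  rw [caputo_eq_smul_tsum_caputoTerm hα0 hα1,
    tsum_congr (caputoTerm_eq_smul_kernelTerm hq0 hα0 hα1 ht u), h1.tsum_eq, smul_smul, smul_smul]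
  congr 1
  have := (qGamma_one_sub_pos hq0 hq1 hα1).ne'
  norm_cast
  field_simp

theorem hasSum_kernelTerm_of_summable [T2Space E] (hq0 : 0 < q) (hq1 : q < 1) (hα0 : 0 < α)
    (hα1 : α < 1) (ht : 0 < t) {u : ℝ → E} (h : Summable (caputoTerm 𝕜 q α u t)) :
    HasSum (kernelTerm 𝕜 q α u t)
      (((t ^ α * qGamma q (1 - α) : ℝ) : 𝕜) • caputo 𝕜 q α u t) := by
  have h1 := ((summable_caputoTerm_iff hq0 hq1 hα0 hα1 ht u).1 h).hasSum
  rw [caputo_eq_of_hasSum hq0 hq1 hα0 hα1 ht h1, smul_smul]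
  have hΓ := (qGamma_one_sub_pos hq0 hq1 hα1).ne'
  have e : t ^ α * qGamma q (1 - α) * (t ^ (-α) / qGamma q (1 - α)) = 1 := by
    have := (Real.rpow_pos_of_pos ht α).ne'
    rw [Real.rpow_neg ht.le]
    field_simp
  rw [← RCLike.ofReal_mul, e, RCLike.ofReal_one, one_smul]
  exact h1

end Caputo

/-! ### Scalar modes: eigenvalue equation, decay and gap -/

section Scalar

variable {q α : ℝ}

theorem mul_pow_rpow (hq0 : 0 < q) {t : ℝ} (ht : 0 ≤ t) (n : ℕ) :
    (t * q ^ n) ^ α = t ^ α * (q ^ α) ^ n := by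
  rw [Real.mul_rpow ht (pow_pos hq0 n).le, ← Real.rpow_natCast_mul hq0.le, mul_comm,
    ← Real.rpow_mul_natCast hq0.le, mul_comm (n : ℝ)]
  ring

/-- The Mittag-Leffler function `t ↦ e_{α, 1}(-μ t ^ α; q)`. -/
def mlMode (q α μ t : ℝ) : ℝ := qMittagLeffler q α 1 (-μ * t ^ α)

theorem neg_mul_rpow_nonpos {μ t : ℝ} (hμ : 0 ≤ μ) (ht : 0 ≤ t) : -μ * t ^ α ≤ 0 := by
  have := Real.rpow_nonneg ht α
  nlinarith

theorem mlMode_zero (hq0 : 0 < q) (hq1 : q < 1) (hα0 : 0 < α) (μ : ℝ) : mlMode q α μ 0 = 1 := by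
  rw [mlMode, Real.zero_rpow hα0.ne', mul_zero, qMittagLeffler_eq_mlSeries hq0 hq1 hα0 le_rfl,
    zero_mul, mlSeries_zero hq0 hq1]

/-- The Lipschitz bound of the partial fractions; its factor `μ` is what later costs two Sobolev
orders. -/
theorem abs_mlMode_sub_le (hq0 : 0 < q) (hq1 : q < 1) (hα0 : 0 < α) {μ s t : ℝ} (hμ : 0 ≤ μ)
    (hs : 0 ≤ s) (ht : 0 ≤ t) :
    |mlMode q α μ s - mlMode q α μ t| ≤ mlLip q * (1 - q) ^ α * μ * |s ^ α - t ^ α| := by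
  have hp0 : 0 < q ^ α := Real.rpow_pos_of_pos hq0 α
  have hp1 : q ^ α < 1 := Real.rpow_lt_one hq0.le hq1 hα0
  have hc : 0 < (1 - q) ^ α := Real.rpow_pos_of_pos (by linarith) α
  have h1 := neg_mul_rpow_nonpos (α := α) hμ hs
  have h2 := neg_mul_rpow_nonpos (α := α) hμ ht
  rw [mlMode, mlMode, qMittagLeffler_eq_mlSeries hq0 hq1 hα0 h1,
    qMittagLeffler_eq_mlSeries hq0 hq1 hα0 h2]
  refine (abs_mlSeries_sub_le hq0 hq1 hp0 hp1 (mul_nonpos_of_nonpos_of_nonneg h1 hc.le)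
    (mul_nonpos_of_nonpos_of_nonneg h2 hc.le)).trans (le_of_eq ?_)
  rw [← sub_mul, ← mul_sub, abs_mul, abs_mul, abs_neg, abs_of_nonneg hμ, abs_of_pos hc]
  ring

theorem tendsto_mlMode (hq0 : 0 < q) (hq1 : q < 1) (hα0 : 0 < α) {μ t : ℝ} (hμ : 0 ≤ μ)
    (ht : 0 ≤ t) : Tendsto (fun n : ℕ => mlMode q α μ (t * q ^ n)) atTop (𝓝 1) := by
  have hp0 : 0 < q ^ α := Real.rpow_pos_of_pos hq0 α
  have hp1 : q ^ α < 1 := Real.rpow_lt_one hq0.le hq1 hα0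
  have h0 : Tendsto (fun n : ℕ => mlLip q * (1 - q) ^ α * μ * (t ^ α * (q ^ α) ^ n)) atTop
      (𝓝 0) := by
    simpa using ((tendsto_pow_atTop_nhds_zero_of_lt_one hp0.le hp1).const_mul (t ^ α)).const_mul
      (mlLip q * (1 - q) ^ α * μ)
  rw [tendsto_iff_norm_sub_tendsto_zero]
  refine squeeze_zero (fun _ => norm_nonneg _) (fun n => ?_) h0
  have h := abs_mlMode_sub_le hq0 hq1 hα0 hμ (mul_nonneg ht (pow_pos hq0 n).le) (le_refl (0 : ℝ))
  rwa [mlMode_zero hq0 hq1 hα0, mul_pow_rpow hq0 ht, Real.zero_rpow hα0.ne', sub_zero,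
    abs_of_nonneg (mul_nonneg (Real.rpow_nonneg ht α) (pow_pos hp0 n).le)] at h

/-- The lattice equation applies because `t ↦ t q` multiplies the argument of `mlSeries` by `q^α`.
-/
theorem hasSum_kernel_mlMode (hq0 : 0 < q) (hq1 : q < 1) (hα0 : 0 < α) (hα1 : α < 1) {μ t : ℝ}
    (hμ : 0 ≤ μ) (ht : 0 ≤ t) :
    HasSum (fun n : ℕ => latticeKernel q α n *
        (mlMode q α μ (t * q ^ n) - mlMode q α μ (t * q ^ (n + 1))))
      (-(μ * (t ^ α * qGamma q (1 - α))) * mlMode q α μ t) := by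
  have hc : 0 < (1 - q) ^ α := Real.rpow_pos_of_pos (by linarith) α
  have hw : -μ * t ^ α * (1 - q) ^ α ≤ 0 :=
    mul_nonpos_of_nonpos_of_nonneg (neg_mul_rpow_nonpos hμ ht) hc.le
  have hmode : ∀ n : ℕ, mlMode q α μ (t * q ^ n) =
      mlSeries q (q ^ α) (-μ * t ^ α * (1 - q) ^ α * (q ^ α) ^ n) := by
    intro n
    rw [mlMode, qMittagLeffler_eq_mlSeries hq0 hq1 hα0
      (neg_mul_rpow_nonpos hμ (mul_nonneg ht (pow_pos hq0 n).le)), mul_pow_rpow hq0 ht]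
    congr 1
    ring
  have h := hasSum_latticeKernel_mlSeries hq0 hq1 hα0 hα1 hw
  have h0 := hmode 0
  simp only [pow_zero, mul_one] at h0
  simp only [hmode]
  rw [h0, ← latticeKernel_zero_mul_rpow hq0]
  convert! h using 1
  ring

/-- The maximum principle along `t q^n`, where the limit is `1`. No sign or monotonicity of the
Mittag-Leffler function is needed. -/
theorem mlMode_bound (hq0 : 0 < q) (hq1 : q < 1) (hα0 : 0 < α) (hα1 : α < 1) {μ t : ℝ}
    (hμ : 0 ≤ μ) (ht : 0 ≤ t) :
    (latticeKernel q α 0 + μ * (t ^ α * qGamma q (1 - α))) * |mlMode q α μ t| ≤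
      latticeKernel q α 0 := by
  have hΓ := qGamma_one_sub_pos hq0 hq1 hα1
  have htn : ∀ n : ℕ, 0 ≤ t * q ^ n := fun n => mul_nonneg ht (pow_pos hq0 n).le
  have h := norm_le_norm_limit_of_kernel (𝕜 := ℝ) (latticeKernel_antitone hq0 hq1 hα0 hα1)
    (latticeKernel_pos hq0 hq1 hα1) (a := fun n => mlMode q α μ (t * q ^ n))
    (c := fun n => μ * ((t * q ^ n) ^ α * qGamma q (1 - α))) (fun n => by
      have := Real.rpow_nonneg (htn n) α
      positivity) (tendsto_mlMode hq0 hq1 hα0 hμ ht) (fun n => by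
      refine (hasSum_kernel_mlMode hq0 hq1 hα0 hα1 hμ (htn n)).congr_fun fun j => ?_
      simp only [RCLike.ofReal_real_eq_id, id, pow_add, mul_assoc])
  simpa using h

theorem abs_mlMode_le_one (hq0 : 0 < q) (hq1 : q < 1) (hα0 : 0 < α) (hα1 : α < 1) {μ t : ℝ}
    (hμ : 0 ≤ μ) (ht : 0 ≤ t) : |mlMode q α μ t| ≤ 1 := by
  have h := mlMode_bound hq0 hq1 hα0 hα1 hμ ht
  have hK := latticeKernel_pos hq0 hq1 hα1 0
  have hΓ := qGamma_one_sub_pos hq0 hq1 hα1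
  have h1 : 0 ≤ μ * (t ^ α * qGamma q (1 - α)) * |mlMode q α μ t| := by
    have := Real.rpow_nonneg ht α
    positivity
  refine le_of_mul_le_mul_left ?_ hK
  linarith

/-- A lower bound, uniform in `μ ≥ m`, of `1 - e_{α, 1}(-μ T ^ α; q)`. -/
def modeGap (q α m T : ℝ) : ℝ :=
  m * (T ^ α * qGamma q (1 - α)) / (latticeKernel q α 0 + m * (T ^ α * qGamma q (1 - α)))

theorem modeGap_pos (hq0 : 0 < q) (hq1 : q < 1) (hα1 : α < 1) {m T : ℝ} (hm : 0 < m)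
    (hT : 0 < T) : 0 < modeGap q α m T := by
  have hK := latticeKernel_pos hq0 hq1 hα1 0
  have hΓ := qGamma_one_sub_pos hq0 hq1 hα1
  have := Real.rpow_pos_of_pos hT α
  rw [modeGap]
  positivity

/-- The bound `K_0 / (K_0 + μ T^α Γ_q(1-α))` for the mode decreases in `μ`, so `μ = m` is the worst
case; `m > 0` takes care of a zero eigenvalue. -/
theorem modeGap_le (hq0 : 0 < q) (hq1 : q < 1) (hα0 : 0 < α) (hα1 : α < 1) {m μ T : ℝ}
    (hm : 0 < m) (hμ : m ≤ μ) (hT : 0 < T) : modeGap q α m T ≤ 1 - mlMode q α μ T := by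
  have hK := latticeKernel_pos hq0 hq1 hα1 0
  have hG : 0 < T ^ α * qGamma q (1 - α) :=
    mul_pos (Real.rpow_pos_of_pos hT α) (qGamma_one_sub_pos hq0 hq1 hα1)
  have h := mlMode_bound hq0 hq1 hα0 hα1 (hm.le.trans hμ) hT.le
  rw [modeGap]
  generalize T ^ α * qGamma q (1 - α) = G at *
  generalize latticeKernel q α 0 = K at *
  have hle : mlMode q α μ T ≤ |mlMode q α μ T| := le_abs_self _
  have h2 : m * G * |mlMode q α μ T| ≤ μ * G * |mlMode q α μ T| := by gcongr
  have hmG : 0 < m * G := mul_pos hm hG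
  rw [div_le_iff₀ (by linarith)]
  have h3 : (K + m * G) * mlMode q α μ T ≤ (K + m * G) * |mlMode q α μ T| :=
    mul_le_mul_of_nonneg_left hle (by linarith)
  linarith

/-- The maximum principle for the solution `v` of `ᶜD_q^α v + μ v = h`, `v(0) = 0`, compared with the
stationary solution `h / μ`. -/
theorem norm_sub_le_of_kernel_equation {𝕜 : Type*} [RCLike 𝕜] (hq0 : 0 < q) (hq1 : q < 1)
    (hα0 : 0 < α) (hα1 : α < 1) {μ t : ℝ} (hμ : 0 < μ) (ht : 0 < t) {v : ℝ → 𝕜} {h : 𝕜}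
    (hv : Tendsto (fun n : ℕ => v (t * q ^ n)) atTop (𝓝 0))
    (heq : ∀ n : ℕ, HasSum (kernelTerm 𝕜 q α v (t * q ^ n))
      ((((t * q ^ n) ^ α * qGamma q (1 - α) : ℝ) : 𝕜) * (h - (μ : 𝕜) * v (t * q ^ n)))) :
    ‖v t - h / (μ : 𝕜)‖ * (latticeKernel q α 0 + μ * (t ^ α * qGamma q (1 - α))) ≤
      latticeKernel q α 0 * ‖h / (μ : 𝕜)‖ := by
  have hΓ := qGamma_one_sub_pos hq0 hq1 hα1
  have hμ' : (μ : 𝕜) ≠ 0 := RCLike.ofReal_ne_zero.2 hμ.ne'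
  have htn : ∀ n : ℕ, 0 < t * q ^ n := fun n => mul_pos ht (pow_pos hq0 n)
  have key := norm_le_norm_limit_of_kernel (𝕜 := 𝕜) (latticeKernel_antitone hq0 hq1 hα0 hα1)
    (latticeKernel_pos hq0 hq1 hα1) (a := fun n => v (t * q ^ n) - h / (μ : 𝕜))
    (c := fun n => μ * ((t * q ^ n) ^ α * qGamma q (1 - α))) (fun n => by
      have := Real.rpow_pos_of_pos (htn n) α
      positivity) (hv.sub_const _) (fun n => by
      have e : -((μ * ((t * q ^ n) ^ α * qGamma q (1 - α)) : ℝ) : 𝕜) *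
          (v (t * q ^ n) - h / (μ : 𝕜)) =
          (((t * q ^ n) ^ α * qGamma q (1 - α) : ℝ) : 𝕜) * (h - (μ : 𝕜) * v (t * q ^ n)) := by
        rw [RCLike.ofReal_mul μ]
        field_simp
        ring
      rw [e]
      refine (heq n).congr_fun fun j => ?_
      simp only [kernelTerm, smul_eq_mul, sub_sub_sub_cancel_right, pow_add, mul_assoc])
  rw [zero_sub, norm_neg] at key
  rw [mul_comm]
  simpa using key

end Scalar

/-! ### The Sobolev scale -/

section Sobolev

variable {ι 𝕜 𝕜' : Type*} [RCLike 𝕜] [RCLike 𝕜'] {lam : ι → ℝ} {s s' : ℝ}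

theorem sobolevNorm_nonneg (lam : ι → ℝ) (s : ℝ) (a : ι → 𝕜) : 0 ≤ sobolevNorm lam s a :=
  Real.sqrt_nonneg _

theorem sobolev_term_nonneg (hlam : ∀ k, 0 ≤ lam k) (s : ℝ) (a : ι → 𝕜) (k : ι) :
    0 ≤ (1 + lam k) ^ s * ‖a k‖ ^ 2 :=
  mul_nonneg (Real.rpow_nonneg (by linarith [hlam k]) _) (sq_nonneg _)

theorem sobolevNorm_sq (hlam : ∀ k, 0 ≤ lam k) (s : ℝ) (a : ι → 𝕜) :
    sobolevNorm lam s a ^ 2 = ∑' k, (1 + lam k) ^ s * ‖a k‖ ^ 2 :=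
  Real.sq_sqrt (tsum_nonneg (sobolev_term_nonneg hlam s a))

/-- Comparison of Sobolev norms, termwise. -/
theorem MemSobolev.of_term_le (hlam : ∀ k, 0 ≤ lam k) {b : ι → 𝕜'} (hb : MemSobolev lam s' b)
    {a : ι → 𝕜} {c : ℝ} (hc : 0 ≤ c)
    (h : ∀ k, (1 + lam k) ^ s * ‖a k‖ ^ 2 ≤ c ^ 2 * ((1 + lam k) ^ s' * ‖b k‖ ^ 2)) :
    MemSobolev lam s a ∧ sobolevNorm lam s a ≤ c * sobolevNorm lam s' b := by
  have hcb := Summable.mul_left (c ^ 2) hb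
  have ha : MemSobolev lam s a :=
    Summable.of_nonneg_of_le (sobolev_term_nonneg hlam s a) h hcb
  refine ⟨ha, ?_⟩
  refine abs_le_of_sq_le_sq' ?_ (mul_nonneg hc (sobolevNorm_nonneg _ _ _)) |>.2
  rw [mul_pow, sobolevNorm_sq hlam, sobolevNorm_sq hlam, ← tsum_mul_left]
  exact Summable.tsum_le_tsum h ha hcb

/-- The coefficient fields may differ because the majorant used below is the real series `‖φ k‖ + ‖ρ
k‖`. -/
theorem MemSobolev.of_norm_le (hlam : ∀ k, 0 ≤ lam k) {b : ι → 𝕜'} (hb : MemSobolev lam s b)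
    {a : ι → 𝕜} {c : ℝ} (hc : 0 ≤ c) (h : ∀ k, ‖a k‖ ≤ c * ‖b k‖) :
    MemSobolev lam s a ∧ sobolevNorm lam s a ≤ c * sobolevNorm lam s b := by
  refine hb.of_term_le hlam hc fun k => ?_
  have h1 : ‖a k‖ ^ 2 ≤ (c * ‖b k‖) ^ 2 := pow_le_pow_left₀ (norm_nonneg _) (h k) 2
  have h2 : 0 ≤ (1 + lam k) ^ s := Real.rpow_nonneg (by linarith [hlam k]) _
  nlinarith

/-- A factor `1 + λ_k` is worth exactly two orders. -/
theorem MemSobolev.of_norm_le_mul (hlam : ∀ k, 0 ≤ lam k) {b : ι → 𝕜'}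
    (hb : MemSobolev lam (s + 2) b) {a : ι → 𝕜} {c : ℝ} (hc : 0 ≤ c)
    (h : ∀ k, ‖a k‖ ≤ c * ((1 + lam k) * ‖b k‖)) :
    MemSobolev lam s a ∧ sobolevNorm lam s a ≤ c * sobolevNorm lam (s + 2) b := by
  refine hb.of_term_le hlam hc fun k => ?_
  have h1 : ‖a k‖ ^ 2 ≤ (c * ((1 + lam k) * ‖b k‖)) ^ 2 :=
    pow_le_pow_left₀ (norm_nonneg _) (h k) 2
  have h0 : 0 < 1 + lam k := by linarith [hlam k]
  have h2 : 0 ≤ (1 + lam k) ^ s := Real.rpow_nonneg h0.le _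
  rw [Real.rpow_add h0, Real.rpow_two]
  nlinarith

theorem MemSobolev.sub (hlam : ∀ k, 0 ≤ lam k) {a b : ι → 𝕜} (ha : MemSobolev lam s a)
    (hb : MemSobolev lam s b) : MemSobolev lam s (a - b) := by
  refine Summable.of_nonneg_of_le (sobolev_term_nonneg hlam s _) (fun k => ?_)
    (((Summable.add ha hb)).mul_left 2)
  have h2 : 0 ≤ (1 + lam k) ^ s := Real.rpow_nonneg (by linarith [hlam k]) _
  have h3 : ‖(a - b) k‖ ^ 2 ≤ 2 * (‖a k‖ ^ 2 + ‖b k‖ ^ 2) := by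
    have := norm_sub_le (a k) (b k)
    rw [Pi.sub_apply]
    nlinarith [norm_nonneg (a k - b k), sq_nonneg (‖a k‖ - ‖b k‖)]
  nlinarith

theorem MemSobolev.smul (hlam : ∀ k, 0 ≤ lam k) {a : ι → 𝕜} (ha : MemSobolev lam s a) (c : 𝕜) :
    MemSobolev lam s (c • a) :=
  (ha.of_norm_le hlam (norm_nonneg c) fun k => by simp).1

/-- The sum of the moduli of two series. -/
theorem MemSobolev.norm_add_norm (hlam : ∀ k, 0 ≤ lam k) {a b : ι → 𝕜} (ha : MemSobolev lam s a)
    (hb : MemSobolev lam s b) :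
    MemSobolev lam s (fun k => ‖a k‖ + ‖b k‖) ∧
      sobolevNorm lam s (fun k => ‖a k‖ + ‖b k‖) ^ 2 ≤
        2 * (sobolevNorm lam s a ^ 2 + sobolevNorm lam s b ^ 2) := by
  have hle : ∀ k, (1 + lam k) ^ s * ‖‖a k‖ + ‖b k‖‖ ^ 2 ≤
      2 * ((1 + lam k) ^ s * ‖a k‖ ^ 2 + (1 + lam k) ^ s * ‖b k‖ ^ 2) := by
    intro k
    have h2 : 0 ≤ (1 + lam k) ^ s := Real.rpow_nonneg (by linarith [hlam k]) _
    have h3 : ‖‖a k‖ + ‖b k‖‖ ^ 2 ≤ 2 * (‖a k‖ ^ 2 + ‖b k‖ ^ 2) := by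
      rw [Real.norm_eq_abs, sq_abs]
      nlinarith [sq_nonneg (‖a k‖ - ‖b k‖)]
    nlinarith
  have hs := (Summable.add ha hb).mul_left 2
  have hm : MemSobolev lam s (fun k => ‖a k‖ + ‖b k‖) :=
    Summable.of_nonneg_of_le (sobolev_term_nonneg hlam s _) hle hs
  refine ⟨hm, ?_⟩
  rw [sobolevNorm_sq hlam, sobolevNorm_sq hlam, sobolevNorm_sq hlam, ← Summable.tsum_add ha hb,
    ← tsum_mul_left]
  exact Summable.tsum_le_tsum hle hm hs

/-- One term is at most the whole sum. This continuity of the coefficients reduces uniqueness to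
scalar equations. -/
theorem MemSobolev.norm_apply_le (hlam : ∀ k, 0 ≤ lam k) {a : ι → 𝕜} (ha : MemSobolev lam s a)
    (k : ι) : ‖a k‖ ≤ (√((1 + lam k) ^ s))⁻¹ * sobolevNorm lam s a := by
  have h0 : 0 < (1 + lam k) ^ s := Real.rpow_pos_of_pos (by linarith [hlam k]) _
  have h1 : (1 + lam k) ^ s * ‖a k‖ ^ 2 ≤ ∑' k, (1 + lam k) ^ s * ‖a k‖ ^ 2 :=
    Summable.le_tsum ha k fun j _ => sobolev_term_nonneg hlam s a j
  rw [← div_eq_inv_mul, le_div_iff₀ (Real.sqrt_pos.2 h0), sobolevNorm]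
  refine Real.le_sqrt_of_sq_le ?_
  rw [mul_pow, Real.sq_sqrt h0.le, mul_comm]
  exact h1

/-- Absolutely convergent series in a Sobolev space converge coefficientwise. -/
theorem summable_of_summable_sobolevNorm (hlam : ∀ k, 0 ≤ lam k) {g : ℕ → ι → 𝕜}
    (hg : ∀ n, MemSobolev lam s (g n)) (h : Summable fun n => sobolevNorm lam s (g n)) :
    Summable g :=
  Pi.summable.2 fun k => Summable.of_norm_bounded (h.mul_left _)
    fun n => (hg n).norm_apply_le hlam k

theorem eigenSeries_self_smul {H : Type*} [NormedAddCommGroup H] [InnerProductSpace 𝕜 H]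
    [DecidableEq ι] (ψ : HilbertBasis ι 𝕜 H) (k j : ι) (c : 𝕜) :
    (c • eigenSeries ψ (ψ k)) j = if j = k then c else 0 := by
  rw [Pi.smul_apply, eigenSeries, orthonormal_iff_ite.1 ψ.orthonormal, smul_eq_mul]
  split_ifs <;> simp

/-- The eigenfunction expansion of an element of a Sobolev space. -/
theorem MemSobolev.sobolevHasSum {H : Type*} [NormedAddCommGroup H] [InnerProductSpace 𝕜 H]
    (ψ : HilbertBasis ι 𝕜 H) {a : ι → 𝕜} (ha : MemSobolev lam s a) :
    SobolevHasSum lam s (fun k => a k • eigenSeries ψ (ψ k)) a := by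
  classical
  refine ⟨ha, fun k => ?_, ?_⟩
  · refine summable_of_ne_finset_zero (s := {k}) fun j hj => ?_
    beta_reduce
    rw [eigenSeries_self_smul, if_neg (by simpa using hj)]
    simp
  -- The squared norm of the remainder is the tail of the series defining the squared norm of `a`.
  · have hres : ∀ S : Finset ι, sobolevNorm lam s (a - ∑ k ∈ S, a k • eigenSeries ψ (ψ k)) =
        √(∑' k, (1 + lam k) ^ s * ‖a k‖ ^ 2 - ∑ k ∈ S, (1 + lam k) ^ s * ‖a k‖ ^ 2) := by
      intro S
      rw [sobolevNorm]
      congr 1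
      have h1 : HasSum (fun k => if k ∈ S then (1 + lam k) ^ s * ‖a k‖ ^ 2 else 0)
          (∑ k ∈ S, (1 + lam k) ^ s * ‖a k‖ ^ 2) := by
        have := hasSum_sum_of_ne_finset_zero (L := .unconditional ι)
          (f := fun k => if k ∈ S then (1 + lam k) ^ s * ‖a k‖ ^ 2 else 0) (s := S)
          (fun k hk => if_neg hk)
        rwa [Finset.sum_congr rfl fun k hk => if_pos hk] at this
      rw [← (Summable.hasSum ha |>.sub h1).tsum_eq]
      refine tsum_congr fun j => ?_
      have h2 : (∑ k ∈ S, a k • eigenSeries ψ (ψ k)) j = if j ∈ S then a j else 0 := by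
        rw [Finset.sum_apply]
        simp_rw [eigenSeries_self_smul]
        rw [Finset.sum_ite_eq]
      rw [Pi.sub_apply, h2]
      split_ifs <;> simp
    simp only [hres]
    have h3 := (Summable.hasSum ha).const_sub (∑' k, (1 + lam k) ^ s * ‖a k‖ ^ 2)
    rw [sub_self] at h3
    have h4 := (Real.continuous_sqrt.tendsto 0).comp h3
    rw [Real.sqrt_zero] at h4
    exact h4

end Sobolev

/-! ### Vectors of the Hilbert space -/

section Hilbert

variable {ι 𝕜 H : Type*} [RCLike 𝕜] [NormedAddCommGroup H] [InnerProductSpace 𝕜 H]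
  {lam : ι → ℝ} (ψ : HilbertBasis ι 𝕜 H)

theorem eigenSeries_injective : Function.Injective (eigenSeries ψ) := by
  intro v w h
  apply ψ.repr.injective
  ext k
  rw [HilbertBasis.repr_apply_apply, HilbertBasis.repr_apply_apply]
  exact congrFun h k

theorem eigenSeries_add (v w : H) : eigenSeries ψ (v + w) = eigenSeries ψ v + eigenSeries ψ w :=
  funext fun _ => inner_add_right _ _ _

theorem eigenSeries_sub (v w : H) : eigenSeries ψ (v - w) = eigenSeries ψ v - eigenSeries ψ w :=
  funext fun _ => inner_sub_right _ _ _

theorem eigenSeries_smul (c : 𝕜) (v : H) : eigenSeries ψ (c • v) = c • eigenSeries ψ v :=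
  funext fun _ => inner_smul_right _ _ _

theorem HasSum.eigenSeries {β : Type*} {g : β → H} {v : H} (h : HasSum g v) :
    HasSum (fun n => eigenSeries ψ (g n)) (eigenSeries ψ v) :=
  Pi.hasSum.2 fun k => h.mapL (innerSL 𝕜 (ψ k))

/-- Parseval's identity, obtained from the real part of the expansion of `⟨v, v⟩`. -/
theorem norm_sq_eq_tsum_eigenSeries (v : H) :
    HasSum (fun k => ‖eigenSeries ψ v k‖ ^ 2) (‖v‖ ^ 2) := by
  have h := (ψ.hasSum_inner_mul_inner v v).mapL (RCLike.reCLM (K := 𝕜))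
  simp only [RCLike.reCLM_apply, inner_self_eq_norm_sq] at h
  refine h.congr_fun fun k => ?_
  rw [eigenSeries, ← inner_conj_symm v (ψ k), RCLike.conj_mul]
  norm_cast

theorem norm_le_sobolevNorm (hlam : ∀ k, 0 ≤ lam k) {d : ℝ} (hd : 0 ≤ d) {v : H}
    (hv : MemSobolev lam d (eigenSeries ψ v)) : ‖v‖ ≤ sobolevNorm lam d (eigenSeries ψ v) := by
  refine Real.le_sqrt_of_sq_le ?_
  rw [← (norm_sq_eq_tsum_eigenSeries ψ v).tsum_eq]
  refine Summable.tsum_le_tsum (fun k => ?_) (norm_sq_eq_tsum_eigenSeries ψ v).summable hv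
  exact le_mul_of_one_le_left (sq_nonneg _) (Real.one_le_rpow (by linarith [hlam k]) hd)

/-- A vector whose series is mapped into `H` by the operator lies in the domain. -/
theorem mem_domain_of_seriesOp_eq [CompleteSpace H] {L : H →ₗ.[𝕜] H} (hL : IsSelfAdjoint L)
    (hψ : ∀ k, ∃ h : ψ k ∈ L.domain, L ⟨ψ k, h⟩ = (lam k : 𝕜) • ψ k) {v w : H}
    (hw : eigenSeries ψ w = seriesOp lam (eigenSeries ψ v)) :
    ∃ h : v ∈ L.domain, L ⟨v, h⟩ = w := by
  have hv : v ∈ L.domain := by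
    -- In the adjoint's domain it suffices that some vector represents `x ↦ ⟨v, L x⟩`; `w` does, by
    -- Parseval and the reality of the eigenvalues.
    rw [← LinearPMap.isSelfAdjoint_def.1 hL]
    refine LinearPMap.mem_adjoint_domain_of_exists v ⟨w, fun x => ?_⟩
    rw [← (ψ.hasSum_inner_mul_inner w x).tsum_eq, ← (ψ.hasSum_inner_mul_inner v (L x)).tsum_eq]
    refine tsum_congr fun k => ?_
    have h1 := congrFun (eigenSeries_apply_eq_seriesOp hL ψ hψ x) k
    have h2 := congrFun hw k
    simp only [eigenSeries, seriesOp] at h1 h2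
    rw [h1, ← inner_conj_symm w, h2, ← inner_conj_symm v, map_mul, RCLike.conj_ofReal]
    ring
  refine ⟨hv, eigenSeries_injective ψ ?_⟩
  rw [eigenSeries_apply_eq_seriesOp hL ψ hψ, hw]

theorem eigenSeries_kernelTerm (q α : ℝ) {U : ℝ → H} {u : ℝ → ι → 𝕜} {t : ℝ}
    (h : ∀ n : ℕ, eigenSeries ψ (U (t * q ^ n)) = u (t * q ^ n)) (n : ℕ) :
    eigenSeries ψ (kernelTerm 𝕜 q α U t n) = kernelTerm 𝕜 q α u t n := by
  rw [kernelTerm, kernelTerm, eigenSeries_smul, eigenSeries_sub, h, h]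

end Hilbert

/-! ### The inverse problem for a single mode -/

section Mode

variable {𝕜 : Type*} [RCLike 𝕜] {q α m μ T : ℝ}

/-- The coefficient `(x - y) / (1 - e_{α, 1}(-μ T ^ α; q))` of a mode with end values `x`, `y`. -/
def modeCoeff (q α μ T : ℝ) (x y : 𝕜) : 𝕜 := (x - y) / ((1 - mlMode q α μ T : ℝ) : 𝕜)

/-- The solution of the scalar inverse problem. -/
def modeSol (q α μ T : ℝ) (x y : 𝕜) (t : ℝ) : 𝕜 :=
  x + modeCoeff q α μ T x y * ((mlMode q α μ t - 1 : ℝ) : 𝕜)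

theorem modeSol_zero (hq0 : 0 < q) (hq1 : q < 1) (hα0 : 0 < α) (x y : 𝕜) :
    modeSol q α μ T x y 0 = x := by
  simp [modeSol, mlMode_zero hq0 hq1 hα0]

theorem modeSol_final (h : mlMode q α μ T < 1) (x y : 𝕜) : modeSol q α μ T x y T = y := by
  have h1 : ((1 - mlMode q α μ T : ℝ) : 𝕜) ≠ 0 := RCLike.ofReal_ne_zero.2 (by linarith)
  have e : ((mlMode q α μ T - 1 : ℝ) : 𝕜) = -((1 - mlMode q α μ T : ℝ) : 𝕜) := by
    push_cast; ring
  rw [modeSol, modeCoeff, e, mul_neg, div_mul_cancel₀ _ h1]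
  ring

theorem modeSol_sub (x y : 𝕜) (s t : ℝ) : modeSol q α μ T x y s - modeSol q α μ T x y t =
    modeCoeff q α μ T x y * ((mlMode q α μ s - mlMode q α μ t : ℝ) : 𝕜) := by
  rw [modeSol, modeSol]
  push_cast
  ring

theorem norm_modeCoeff_le (hq0 : 0 < q) (hq1 : q < 1) (hα0 : 0 < α) (hα1 : α < 1) (hm : 0 < m)
    (hμ : m ≤ μ) (hT : 0 < T) (x y : 𝕜) :
    ‖modeCoeff q α μ T x y‖ ≤ (modeGap q α m T)⁻¹ * (‖x‖ + ‖y‖) := by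
  have h1 := modeGap_pos hq0 hq1 hα1 hm hT
  have h2 := modeGap_le hq0 hq1 hα0 hα1 hm hμ hT
  rw [modeCoeff, norm_div, RCLike.norm_ofReal, abs_of_pos (by linarith), div_eq_inv_mul]
  have := norm_sub_le x y
  gcongr

theorem norm_modeSol_le (hq0 : 0 < q) (hq1 : q < 1) (hα0 : 0 < α) (hα1 : α < 1) (hm : 0 < m)
    (hμ : m ≤ μ) (hT : 0 < T) (x y : 𝕜) {t : ℝ} (ht : 0 ≤ t) :
    ‖modeSol q α μ T x y t‖ ≤ (1 + 2 * (modeGap q α m T)⁻¹) * (‖x‖ + ‖y‖) := by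
  have h1 := norm_modeCoeff_le hq0 hq1 hα0 hα1 hm hμ hT x y
  have h2 : |mlMode q α μ t - 1| ≤ 2 := by
    have := abs_le.1 (abs_mlMode_le_one hq0 hq1 hα0 hα1 (hm.le.trans hμ) ht)
    rw [abs_le]
    constructor <;> linarith
  have h3 : ‖modeCoeff q α μ T x y * ((mlMode q α μ t - 1 : ℝ) : 𝕜)‖ ≤
      (modeGap q α m T)⁻¹ * (‖x‖ + ‖y‖) * 2 := by
    rw [norm_mul, RCLike.norm_ofReal]
    exact mul_le_mul h1 h2 (abs_nonneg _) ((norm_nonneg _).trans h1)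
  have h4 := norm_add_le x (modeCoeff q α μ T x y * ((mlMode q α μ t - 1 : ℝ) : 𝕜))
  have := norm_nonneg y
  rw [modeSol]
  linarith

theorem norm_modeSol_sub_le (hq0 : 0 < q) (hq1 : q < 1) (hα0 : 0 < α) (hα1 : α < 1) (hm : 0 < m)
    (hμ : m ≤ μ) (hT : 0 < T) (x y : 𝕜) {s t : ℝ} (hs : 0 ≤ s) (ht : 0 ≤ t) :
    ‖modeSol q α μ T x y s - modeSol q α μ T x y t‖ ≤
      (modeGap q α m T)⁻¹ * (mlLip q * (1 - q) ^ α) * |s ^ α - t ^ α| * (μ * (‖x‖ + ‖y‖)) := by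
  have h1 := norm_modeCoeff_le hq0 hq1 hα0 hα1 hm hμ hT x y
  rw [modeSol_sub, norm_mul, RCLike.norm_ofReal]
  refine (mul_le_mul h1 (abs_mlMode_sub_le hq0 hq1 hα0 (hm.le.trans hμ) hs ht) (abs_nonneg _)
    ((norm_nonneg _).trans h1)).trans (le_of_eq ?_)
  ring

theorem hasSum_kernelTerm_modeSol (hq0 : 0 < q) (hq1 : q < 1) (hα0 : 0 < α) (hα1 : α < 1)
    (hμ : 0 ≤ μ) (x y : 𝕜) {t : ℝ} (ht : 0 ≤ t) :
    HasSum (kernelTerm 𝕜 q α (modeSol q α μ T x y) t)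
      (((t ^ α * qGamma q (1 - α) : ℝ) : 𝕜) *
        -((μ : 𝕜) * ((mlMode q α μ t : ℝ) : 𝕜) * modeCoeff q α μ T x y)) := by
  have h := ((hasSum_kernel_mlMode hq0 hq1 hα0 hα1 hμ ht).mapL (RCLike.ofRealCLM (K := 𝕜))).mul_left
    (modeCoeff q α μ T x y)
  convert! h using 1
  · funext n
    rw [kernelTerm, modeSol_sub, smul_eq_mul, RCLike.ofRealCLM_apply, RCLike.ofReal_mul]
    ring
  · rw [RCLike.ofRealCLM_apply]
    push_cast
    ring

end Mode

/-! ### Solutions in the Sobolev scale -/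

section Solution

variable {ι 𝕜 : Type*} [RCLike 𝕜] {lam : ι → ℝ} {q α m T d : ℝ} {φ ρ : ι → 𝕜}

/-- The solution `u` of the inverse problem. -/
def inverseSol (lam : ι → ℝ) (q α m T : ℝ) (φ ρ : ι → 𝕜) (t : ℝ) : ι → 𝕜 :=
  fun k => modeSol q α (lam k + m) T (φ k) (ρ k) t

/-- The source `f` of the inverse problem. -/
def inverseSource (lam : ι → ℝ) (q α m T : ℝ) (φ ρ : ι → 𝕜) : ι → 𝕜 :=
  fun k => ((lam k + m : ℝ) : 𝕜) * (φ k - modeCoeff q α (lam k + m) T (φ k) (ρ k))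

/-- The Caputo derivative of the solution. -/
def inverseCaputo (lam : ι → ℝ) (q α m T : ℝ) (φ ρ : ι → 𝕜) (t : ℝ) : ι → 𝕜 :=
  fun k => -(((lam k + m : ℝ) : 𝕜) * ((mlMode q α (lam k + m) t : ℝ) : 𝕜) *
    modeCoeff q α (lam k + m) T (φ k) (ρ k))

/-- With `E` the mode and `c` its coefficient, `-μ E c + μ (x + c (E - 1)) = μ (x - c)`: the time
dependence cancels. -/
theorem inverseCaputo_add (t : ℝ) :
    inverseCaputo lam q α m T φ ρ t + seriesOp lam (inverseSol lam q α m T φ ρ t) +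
      (m : 𝕜) • inverseSol lam q α m T φ ρ t = inverseSource lam q α m T φ ρ := by
  funext k
  simp only [Pi.add_apply, Pi.smul_apply, smul_eq_mul, inverseCaputo, inverseSol, inverseSource,
    seriesOp, modeSol]
  push_cast
  ring

theorem hasSum_kernelTerm_inverseSol (hlam : ∀ k, 0 ≤ lam k) (hq0 : 0 < q) (hq1 : q < 1)
    (hα0 : 0 < α) (hα1 : α < 1) (hm : 0 < m) {t : ℝ} (ht : 0 ≤ t) :
    HasSum (kernelTerm 𝕜 q α (inverseSol lam q α m T φ ρ) t)
      (((t ^ α * qGamma q (1 - α) : ℝ) : 𝕜) • inverseCaputo lam q α m T φ ρ t) :=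
  Pi.hasSum.2 fun k =>
    hasSum_kernelTerm_modeSol hq0 hq1 hα0 hα1 (by linarith [hlam k]) (φ k) (ρ k) ht

theorem caputo_inverseSol (hlam : ∀ k, 0 ≤ lam k) (hq0 : 0 < q) (hq1 : q < 1)
    (hα0 : 0 < α) (hα1 : α < 1) (hm : 0 < m) {t : ℝ} (ht : 0 < t) :
    caputo 𝕜 q α (inverseSol lam q α m T φ ρ) t = inverseCaputo lam q α m T φ ρ t := by
  rw [caputo_eq_of_hasSum hq0 hq1 hα0 hα1 ht
    (hasSum_kernelTerm_inverseSol hlam hq0 hq1 hα0 hα1 hm ht.le), smul_smul, ← RCLike.ofReal_mul]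
  have h1 := (qGamma_one_sub_pos hq0 hq1 hα1).ne'
  have h2 := (Real.rpow_pos_of_pos ht α).ne'
  have e : t ^ (-α) / qGamma q (1 - α) * (t ^ α * qGamma q (1 - α)) = 1 := by
    rw [Real.rpow_neg ht.le]
    field_simp
  rw [e, RCLike.ofReal_one, one_smul]

theorem add_mul_le_one_add_mul {l m x : ℝ} (hl : 0 ≤ l) (hm : 0 < m) (hx : 0 ≤ x) :
    (l + m) * x ≤ (1 + m) * ((1 + l) * x) := by
  nlinarith [mul_nonneg hl hx, mul_nonneg (mul_nonneg hm.le hl) hx]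

section Bounds

variable (hlam : ∀ k, 0 ≤ lam k) (hq0 : 0 < q) (hq1 : q < 1) (hα0 : 0 < α) (hα1 : α < 1)
  (hm : 0 < m) (hT : 0 < T) (hφ : MemSobolev lam (d + 2) φ) (hρ : MemSobolev lam (d + 2) ρ)

include hlam hq0 hq1 hα0 hα1 hm hT hφ hρ

theorem inverseSol_bound {t : ℝ} (ht : 0 ≤ t) :
    MemSobolev lam (d + 2) (inverseSol lam q α m T φ ρ t) ∧
      sobolevNorm lam (d + 2) (inverseSol lam q α m T φ ρ t) ≤
        (1 + 2 * (modeGap q α m T)⁻¹) * sobolevNorm lam (d + 2) fun k => ‖φ k‖ + ‖ρ k‖ := by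
  have hδ := inv_pos.2 (modeGap_pos hq0 hq1 hα1 hm hT)
  refine (hφ.norm_add_norm hlam hρ).1.of_norm_le hlam (by positivity) fun k => ?_
  rw [Real.norm_of_nonneg (by positivity)]
  exact norm_modeSol_le hq0 hq1 hα0 hα1 hm (by linarith [hlam k]) hT _ _ ht

/-- Quantitative continuity in time, paid for with two orders. It yields both `q`-regularity at `0`
and convergence of the Jackson sum. -/
theorem inverseSol_sub_bound {s t : ℝ} (hs : 0 ≤ s) (ht : 0 ≤ t) :
    MemSobolev lam d (inverseSol lam q α m T φ ρ s - inverseSol lam q α m T φ ρ t) ∧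
      sobolevNorm lam d (inverseSol lam q α m T φ ρ s - inverseSol lam q α m T φ ρ t) ≤
        (modeGap q α m T)⁻¹ * (mlLip q * (1 - q) ^ α) * |s ^ α - t ^ α| * (1 + m) *
          sobolevNorm lam (d + 2) fun k => ‖φ k‖ + ‖ρ k‖ := by
  have hδ := inv_pos.2 (modeGap_pos hq0 hq1 hα1 hm hT)
  have hc : 0 < (1 - q) ^ α := Real.rpow_pos_of_pos (by linarith) α
  have hl := mlLip_nonneg hq0 hq1
  refine (hφ.norm_add_norm hlam hρ).1.of_norm_le_mul hlam (by positivity) fun k => ?_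
  rw [Real.norm_of_nonneg (by positivity), mul_assoc _ (1 + m)]
  refine (norm_modeSol_sub_le hq0 hq1 hα0 hα1 hm (by linarith [hlam k]) hT _ _ hs ht).trans ?_
  exact mul_le_mul_of_nonneg_left (add_mul_le_one_add_mul (hlam k) hm (by positivity))
    (by positivity)

theorem inverseCaputo_bound {t : ℝ} (ht : 0 ≤ t) :
    MemSobolev lam d (inverseCaputo lam q α m T φ ρ t) ∧
      sobolevNorm lam d (inverseCaputo lam q α m T φ ρ t) ≤
        (modeGap q α m T)⁻¹ * (1 + m) * sobolevNorm lam (d + 2) fun k => ‖φ k‖ + ‖ρ k‖ := by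
  have hδ := inv_pos.2 (modeGap_pos hq0 hq1 hα1 hm hT)
  refine (hφ.norm_add_norm hlam hρ).1.of_norm_le_mul hlam (by positivity) fun k => ?_
  have hμ : 0 ≤ lam k + m := by linarith [hlam k]
  rw [Real.norm_of_nonneg (by positivity), inverseCaputo, norm_neg, norm_mul, norm_mul,
    RCLike.norm_ofReal, RCLike.norm_ofReal, abs_of_nonneg hμ]
  calc (lam k + m) * |mlMode q α (lam k + m) t| * ‖modeCoeff q α (lam k + m) T (φ k) (ρ k)‖
      ≤ (lam k + m) * 1 * ((modeGap q α m T)⁻¹ * (‖φ k‖ + ‖ρ k‖)) := by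
        have h1 := abs_mlMode_le_one hq0 hq1 hα0 hα1 hμ ht
        have h2 := norm_modeCoeff_le hq0 hq1 hα0 hα1 hm (by linarith [hlam k] : m ≤ lam k + m) hT
          (φ k) (ρ k)
        gcongr
    _ = (modeGap q α m T)⁻¹ * ((lam k + m) * (‖φ k‖ + ‖ρ k‖)) := by ring
    _ ≤ (modeGap q α m T)⁻¹ * ((1 + m) * ((1 + lam k) * (‖φ k‖ + ‖ρ k‖))) := by
        exact mul_le_mul_of_nonneg_left
          (add_mul_le_one_add_mul (hlam k) hm (by positivity)) (by positivity)
    _ = _ := by ring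

theorem inverseSource_bound :
    MemSobolev lam d (inverseSource lam q α m T φ ρ) ∧
      sobolevNorm lam d (inverseSource lam q α m T φ ρ) ≤
        (1 + (modeGap q α m T)⁻¹) * (1 + m) *
          sobolevNorm lam (d + 2) fun k => ‖φ k‖ + ‖ρ k‖ := by
  have hδ := inv_pos.2 (modeGap_pos hq0 hq1 hα1 hm hT)
  refine (hφ.norm_add_norm hlam hρ).1.of_norm_le_mul hlam (by positivity) fun k => ?_
  have hμ : 0 ≤ lam k + m := by linarith [hlam k]
  rw [Real.norm_of_nonneg (by positivity), inverseSource, norm_mul,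
    RCLike.norm_ofReal, abs_of_nonneg hμ]
  calc (lam k + m) * ‖φ k - modeCoeff q α (lam k + m) T (φ k) (ρ k)‖
      ≤ (lam k + m) * ((1 + (modeGap q α m T)⁻¹) * (‖φ k‖ + ‖ρ k‖)) := by
        have h1 := norm_sub_le (φ k) (modeCoeff q α (lam k + m) T (φ k) (ρ k))
        have h2 := norm_modeCoeff_le hq0 hq1 hα0 hα1 hm (by linarith [hlam k] : m ≤ lam k + m) hT
          (φ k) (ρ k)
        have h3 := norm_nonneg (ρ k)
        gcongr
        linarith
    _ = (1 + (modeGap q α m T)⁻¹) * ((lam k + m) * (‖φ k‖ + ‖ρ k‖)) := by ring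
    _ ≤ (1 + (modeGap q α m T)⁻¹) * ((1 + m) * ((1 + lam k) * (‖φ k‖ + ‖ρ k‖))) := by
        exact mul_le_mul_of_nonneg_left
          (add_mul_le_one_add_mul (hlam k) hm (by positivity)) (by positivity)
    _ = _ := by ring

/-- The increments along the lattice decay like `(q^α)^n`, and the kernel is bounded by `K_0`. -/
theorem summable_sobolevNorm_caputoTerm_inverseSol {t : ℝ} (ht : 0 < t) :
    Summable fun n : ℕ =>
      sobolevNorm lam d (caputoTerm 𝕜 q α (inverseSol lam q α m T φ ρ) t n) := by
  have hp0 : 0 < q ^ α := Real.rpow_pos_of_pos hq0 α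
  have hp1 : q ^ α < 1 := Real.rpow_lt_one hq0.le hq1 hα0
  have hδ := inv_pos.2 (modeGap_pos hq0 hq1 hα1 hm hT)
  have hc : 0 < (1 - q) ^ α := Real.rpow_pos_of_pos (by linarith) α
  have hl := mlLip_nonneg hq0 hq1
  have htα := Real.rpow_pos_of_pos ht α
  have htn : ∀ n : ℕ, 0 ≤ t * q ^ n := fun n => mul_nonneg ht.le (pow_pos hq0 n).le
  set R := sobolevNorm lam (d + 2) fun k => ‖φ k‖ + ‖ρ k‖ with hR
  have hR0 : 0 ≤ R := sobolevNorm_nonneg _ _ _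
  set A := (modeGap q α m T)⁻¹ * (mlLip q * (1 - q) ^ α)
  have hA : 0 ≤ A := by positivity
  set κ := ‖((t ^ (-α) / (t * (1 - q)) : ℝ) : 𝕜)‖
  have hκ : 0 ≤ κ := norm_nonneg _
  refine Summable.of_nonneg_of_le (fun n => sobolevNorm_nonneg _ _ _) (fun n => ?_)
    ((summable_geometric_of_lt_one hp0.le hp1).mul_left
      (κ * latticeKernel q α 0 * (A * t ^ α * (1 + m) * R)))
  have h1 := inverseSol_sub_bound hlam hq0 hq1 hα0 hα1 hm hT hφ hρ (htn n) (htn (n + 1))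
  have h2 : |(t * q ^ n) ^ α - (t * q ^ (n + 1)) ^ α| ≤ t ^ α * (q ^ α) ^ n := by
    rw [mul_pow_rpow hq0 ht.le, mul_pow_rpow hq0 ht.le, pow_succ]
    have := pow_pos hp0 n
    have h3 : 0 < t ^ α * (q ^ α) ^ n := by positivity
    rw [abs_of_nonneg] <;> nlinarith
  have hK := latticeKernel_pos hq0 hq1 hα1 n
  have hK0 := latticeKernel_antitone hq0 hq1 hα0 hα1 (Nat.zero_le n)
  have h4 := h1.1.of_norm_le hlam (a := kernelTerm 𝕜 q α (inverseSol lam q α m T φ ρ) t n)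
    (hK.le.trans hK0) fun k => by
      rw [kernelTerm, Pi.smul_apply, norm_smul, RCLike.norm_ofReal, abs_of_pos hK]
      gcongr
  have h5 := h4.1.of_norm_le hlam (a := caputoTerm 𝕜 q α (inverseSol lam q α m T φ ρ) t n) hκ
    fun k => by
      rw [caputoTerm_eq_smul_kernelTerm hq0 hα0 hα1 ht, Pi.smul_apply, norm_smul]
  have hK0' := hK.le.trans hK0
  calc _ ≤ κ * (latticeKernel q α 0 * (A * (t ^ α * (q ^ α) ^ n) * (1 + m) * R)) := by
        refine h5.2.trans (mul_le_mul_of_nonneg_left (h4.2.trans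
          (mul_le_mul_of_nonneg_left (h1.2.trans ?_) hK0')) hκ)
        gcongr
    _ = _ := by ring

theorem tendsto_inverseSol {t : ℝ} (ht : 0 ≤ t) :
    Tendsto (fun n : ℕ => sobolevNorm lam d
      (inverseSol lam q α m T φ ρ (t * q ^ n) - inverseSol lam q α m T φ ρ 0)) atTop (𝓝 0) := by
  have hp0 : 0 < q ^ α := Real.rpow_pos_of_pos hq0 α
  have hp1 : q ^ α < 1 := Real.rpow_lt_one hq0.le hq1 hα0
  have htn : ∀ n : ℕ, 0 ≤ t * q ^ n := fun n => mul_nonneg ht (pow_pos hq0 n).le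
  have h0 : Tendsto (fun n : ℕ => (modeGap q α m T)⁻¹ * (mlLip q * (1 - q) ^ α) *
      (t ^ α * (q ^ α) ^ n) * (1 + m) * sobolevNorm lam (d + 2) fun k => ‖φ k‖ + ‖ρ k‖) atTop
      (𝓝 0) := by
    simpa using ((((tendsto_pow_atTop_nhds_zero_of_lt_one hp0.le hp1).const_mul (t ^ α)).const_mul
      ((modeGap q α m T)⁻¹ * (mlLip q * (1 - q) ^ α))).mul_const (1 + m)).mul_const
      (sobolevNorm lam (d + 2) fun k => ‖φ k‖ + ‖ρ k‖)
  refine squeeze_zero (fun _ => sobolevNorm_nonneg _ _ _) (fun n => ?_) h0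
  have h := (inverseSol_sub_bound hlam hq0 hq1 hα0 hα1 hm hT hφ hρ (htn n) (le_refl (0 : ℝ))).2
  rwa [mul_pow_rpow hq0 ht, Real.zero_rpow hα0.ne', sub_zero,
    abs_of_nonneg (mul_nonneg (Real.rpow_nonneg ht α) (pow_pos hp0 n).le)] at h

theorem isInverseSolution_inverseSol :
    IsInverseSolution lam q α m T d φ ρ (inverseSol lam q α m T φ ρ)
      (inverseSource lam q α m T φ ρ) := by
  have hu := fun (t : ℝ) (ht : 0 ≤ t) =>
    inverseSol_bound hlam hq0 hq1 hα0 hα1 hm hT hφ hρ ht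
  have hlow : ∀ t, 0 ≤ t → MemSobolev lam d (inverseSol lam q α m T φ ρ t) ∧
      sobolevNorm lam d (inverseSol lam q α m T φ ρ t) ≤
        1 * sobolevNorm lam (d + 2) (inverseSol lam q α m T φ ρ t) := by
    intro t ht
    refine (hu t ht).1.of_norm_le_mul hlam zero_le_one fun k => ?_
    have := hlam k
    have := norm_nonneg (inverseSol lam q α m T φ ρ t k)
    nlinarith
  have hcap := fun (t : ℝ) (ht : 0 < t) =>
    caputo_inverseSol (φ := φ) (ρ := ρ) (T := T) hlam hq0 hq1 hα0 hα1 hm ht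
  have hcb : BddAbove ((fun t => sobolevNorm lam d
      (caputo 𝕜 q α (inverseSol lam q α m T φ ρ) t)) '' Ioc 0 T) := by
    refine ⟨(modeGap q α m T)⁻¹ * (1 + m) * sobolevNorm lam (d + 2) fun k => ‖φ k‖ + ‖ρ k‖,
      forall_mem_image.2 fun t ht => ?_⟩
    rw [hcap t ht.1]
    exact (inverseCaputo_bound hlam hq0 hq1 hα0 hα1 hm hT hφ hρ ht.1.le).2
  refine ⟨⟨fun t ht => (hu t ht.1).1, ⟨_, forall_mem_image.2 fun t ht => (hu t ht.1).2⟩⟩,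
    ⟨⟨fun t ht => (hlow t ht.1).1, ⟨_, forall_mem_image.2 fun t ht =>
      (hlow t ht.1).2.trans (mul_le_mul_of_nonneg_left (hu t ht.1).2 zero_le_one)⟩⟩,
      fun t ht => tendsto_inverseSol hlam hq0 hq1 hα0 hα1 hm hT hφ hρ ht.1.le,
      fun t ht => summable_sobolevNorm_caputoTerm_inverseSol hlam hq0 hq1 hα0 hα1 hm hT hφ hρ ht.1,
      fun t ht => ?_, hcb⟩, fun t ht => ?_, ?_, ?_⟩
  · rw [hcap t ht.1]
    exact (inverseCaputo_bound hlam hq0 hq1 hα0 hα1 hm hT hφ hρ ht.1.le).1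
  · rw [hcap t ht.1, inverseCaputo_add]
  · exact funext fun k => modeSol_zero hq0 hq1 hα0 _ _
  · refine funext fun k => modeSol_final ?_ _ _
    have h1 := modeGap_pos hq0 hq1 hα1 hm hT
    have h2 := modeGap_le hq0 hq1 hα0 hα1 hm (by linarith [hlam k] : m ≤ lam k + m) hT
    linarith

end Bounds

/-- The homogeneous equation, for a single coefficient of the difference of two solutions. -/
theorem IsInverseSolution.kernel_equation (hlam : ∀ k, 0 ≤ lam k) (hq0 : 0 < q) (hq1 : q < 1)
    (hα0 : 0 < α) (hα1 : α < 1) {v : ℝ → ι → 𝕜} {g : ι → 𝕜}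
    (h : IsInverseSolution lam q α m T d φ ρ v g) {t : ℝ} (ht : t ∈ Ioc 0 T) (k : ι) :
    HasSum (kernelTerm 𝕜 q α (fun s => v s k) t)
      (((t ^ α * qGamma q (1 - α) : ℝ) : 𝕜) * (g k - ((lam k + m : ℝ) : 𝕜) * v t k)) := by
  have hmem : ∀ n, MemSobolev lam d (caputoTerm 𝕜 q α v t n) := by
    intro n
    have htn : ∀ n : ℕ, t * q ^ n ∈ Icc 0 T := fun n =>
      ⟨mul_nonneg ht.1.le (pow_pos hq0 n).le,
        (mul_le_of_le_one_right ht.1.le (pow_le_one₀ hq0.le hq1.le)).trans ht.2⟩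
    rw [caputoTerm_eq_smul_kernelTerm hq0 hα0 hα1 ht.1]
    exact (((h.memW.memLinfty.1 _ (htn n)).sub hlam (h.memW.memLinfty.1 _ (htn (n + 1)))).smul
      hlam _).smul hlam _
  -- Absolute convergence in the Sobolev norm gives coefficientwise convergence, so the equation may
  -- be read one coefficient at a time.
  have hs : Summable (caputoTerm 𝕜 q α v t) :=
    summable_of_summable_sobolevNorm hlam hmem (h.memW.summable t ht)
  have h1 := hasSum_kernelTerm_of_summable (u := v) hq0 hq1 hα0 hα1 ht.1 hs
  have h2 := congrFun (h.equation t ht) k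
  have h3 : caputo 𝕜 q α v t k = g k - ((lam k + m : ℝ) : 𝕜) * v t k := by
    simp only [Pi.add_apply, Pi.smul_apply, smul_eq_mul, seriesOp] at h2
    push_cast
    rw [← h2]
    ring
  have h4 := Pi.hasSum.1 h1 k
  rw [Pi.smul_apply, smul_eq_mul, h3] at h4
  exact h4.congr_fun fun n => rfl

theorem IsInverseSolution.tendsto_apply (hlam : ∀ k, 0 ≤ lam k) (hq0 : 0 < q) (hq1 : q < 1)
    {v : ℝ → ι → 𝕜} {g : ι → 𝕜} (hT : 0 ≤ T)
    (h : IsInverseSolution lam q α m T d φ ρ v g) {t : ℝ} (ht : t ∈ Ioc 0 T) (k : ι) :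
    Tendsto (fun n : ℕ => v (t * q ^ n) k) atTop (𝓝 (φ k)) := by
  have htn : ∀ n : ℕ, t * q ^ n ∈ Icc 0 T := fun n =>
    ⟨mul_nonneg ht.1.le (pow_pos hq0 n).le,
      (mul_le_of_le_one_right ht.1.le (pow_le_one₀ hq0.le hq1.le)).trans ht.2⟩
  rw [tendsto_iff_norm_sub_tendsto_zero]
  have h0 := (h.memW.regular t ht).const_mul (√((1 + lam k) ^ d))⁻¹
  rw [mul_zero] at h0
  refine squeeze_zero (fun _ => norm_nonneg _) (fun n => ?_) h0
  rw [← congrFun h.initial k]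
  exact ((h.memW.memLinfty.1 _ (htn n)).sub hlam
    (h.memW.memLinfty.1 0 ⟨le_rfl, hT⟩)).norm_apply_le hlam k

/-- Uniqueness of the solution of the inverse problem. -/
theorem IsInverseSolution.unique (hlam : ∀ k, 0 ≤ lam k) (hq0 : 0 < q) (hq1 : q < 1)
    (hα0 : 0 < α) (hα1 : α < 1) (hm : 0 < m) (hT : 0 < T) {v u : ℝ → ι → 𝕜} {g f : ι → 𝕜}
    (hv : IsInverseSolution lam q α m T d φ ρ v g)
    (hu : IsInverseSolution lam q α m T d φ ρ u f) :
    (∀ t ∈ Icc 0 T, v t = u t) ∧ g = f := by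
  have hΓ := qGamma_one_sub_pos hq0 hq1 hα1
  have hK := latticeKernel_pos hq0 hq1 hα1 0
  have hμ : ∀ k, 0 < lam k + m := fun k => by linarith [hlam k]
  have hμ' : ∀ k, ((lam k + m : ℝ) : 𝕜) ≠ 0 := fun k => RCLike.ofReal_ne_zero.2 (hμ k).ne'
  have key : ∀ k, ∀ t ∈ Ioc 0 T,
      ‖(v t k - u t k) - (g k - f k) / ((lam k + m : ℝ) : 𝕜)‖ *
        (latticeKernel q α 0 + (lam k + m) * (t ^ α * qGamma q (1 - α))) ≤
      latticeKernel q α 0 * ‖(g k - f k) / ((lam k + m : ℝ) : 𝕜)‖ := by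
    intro k t ht
    have htn : ∀ n : ℕ, t * q ^ n ∈ Ioc 0 T := fun n =>
      ⟨mul_pos ht.1 (pow_pos hq0 n),
        (mul_le_of_le_one_right ht.1.le (pow_le_one₀ hq0.le hq1.le)).trans ht.2⟩
    refine norm_sub_le_of_kernel_equation (v := fun s => v s k - u s k) hq0 hq1 hα0 hα1 (hμ k) ht.1
      ?_ fun n => ?_
    · simpa using (hv.tendsto_apply hlam hq0 hq1 hT.le ht k).sub
        (hu.tendsto_apply hlam hq0 hq1 hT.le ht k)
    · have h := (hv.kernel_equation hlam hq0 hq1 hα0 hα1 (htn n) k).sub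
        (hu.kernel_equation hlam hq0 hq1 hα0 hα1 (htn n) k)
      convert! h using 1
      · funext j
        simp only [kernelTerm, smul_eq_mul]
        ring
      · ring
  -- At `t = T` the solutions agree, so `key` bounds the norm of the stationary value by itself
  -- times a factor below `1`. Once it vanishes, `key` at other times gives `v = u`.
  have hgf : ∀ k, g k - f k = 0 := by
    intro k
    have h := key k T ⟨hT, le_rfl⟩
    rw [hv.final, hu.final, sub_self, zero_sub, norm_neg] at h
    have hG : 0 < (lam k + m) * (T ^ α * qGamma q (1 - α)) :=
      mul_pos (hμ k) (mul_pos (Real.rpow_pos_of_pos hT α) hΓ)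
    have h0 := norm_nonneg ((g k - f k) / ((lam k + m : ℝ) : 𝕜))
    have h1 : ‖(g k - f k) / ((lam k + m : ℝ) : 𝕜)‖ = 0 := by nlinarith
    exact (div_eq_zero_iff.1 (norm_eq_zero.1 h1)).resolve_right (hμ' k)
  refine ⟨fun t ht => ?_, funext fun k => sub_eq_zero.1 (hgf k)⟩
  rcases eq_or_lt_of_le ht.1 with rfl | ht0
  · rw [hv.initial, hu.initial]
  · funext k
    have h := key k t ⟨ht0, ht.2⟩
    rw [hgf k, zero_div, norm_zero, mul_zero, sub_zero] at h
    have hG : 0 < (lam k + m) * (t ^ α * qGamma q (1 - α)) :=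
      mul_pos (hμ k) (mul_pos (Real.rpow_pos_of_pos ht0 α) hΓ)
    have h0 := norm_nonneg (v t k - u t k)
    have h1 : ‖v t k - u t k‖ = 0 := by nlinarith
    exact sub_eq_zero.1 (norm_eq_zero.1 h1)

end Solution

/-! ### The solution in the Hilbert space -/

section HilbertSolution

variable {ι 𝕜 H : Type*} [RCLike 𝕜] [NormedAddCommGroup H] [InnerProductSpace 𝕜 H]
  {lam : ι → ℝ} {q α m T d : ℝ} {φ ρ : ι → 𝕜}

theorem eigenSeries_caputoTerm (ψ : HilbertBasis ι 𝕜 H) (hq0 : 0 < q) (hα0 : 0 < α) (hα1 : α < 1)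
    {t : ℝ} (ht : 0 < t) {U : ℝ → H} {u : ℝ → ι → 𝕜}
    (h : ∀ n : ℕ, eigenSeries ψ (U (t * q ^ n)) = u (t * q ^ n)) (n : ℕ) :
    eigenSeries ψ (caputoTerm 𝕜 q α U t n) = caputoTerm 𝕜 q α u t n := by
  rw [caputoTerm_eq_smul_kernelTerm hq0 hα0 hα1 ht, caputoTerm_eq_smul_kernelTerm hq0 hα0 hα1 ht,
    eigenSeries_smul, eigenSeries_kernelTerm ψ q α h]

theorem eigenSeries_caputo (ψ : HilbertBasis ι 𝕜 H) (hq0 : 0 < q) (hq1 : q < 1) (hα0 : 0 < α)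
    (hα1 : α < 1) {t : ℝ} (ht : 0 < t) {U : ℝ → H} {u : ℝ → ι → 𝕜}
    (h : ∀ n : ℕ, eigenSeries ψ (U (t * q ^ n)) = u (t * q ^ n))
    (hs : Summable (caputoTerm 𝕜 q α U t)) :
    eigenSeries ψ (caputo 𝕜 q α U t) = caputo 𝕜 q α u t := by
  have h1 := ((summable_caputoTerm_iff hq0 hq1 hα0 hα1 ht U).1 hs).hasSum
  have h2 := (h1.eigenSeries ψ).congr_fun fun n => (eigenSeries_kernelTerm ψ q α h n).symm
  rw [caputo_eq_of_hasSum hq0 hq1 hα0 hα1 ht h1, caputo_eq_of_hasSum hq0 hq1 hα0 hα1 ht h2,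
    eigenSeries_smul]

/-- For `d ≥ 0` a solution in the Sobolev scale is a solution in `H`, with the operator itself. -/
theorem IsInverseSolution.exists_hilbert_solution [CompleteSpace H] {L : H →ₗ.[𝕜] H}
    (hL : IsSelfAdjoint L) (ψ : HilbertBasis ι 𝕜 H) (hlam : ∀ k, 0 ≤ lam k)
    (hψ : ∀ k, ∃ h : ψ k ∈ L.domain, L ⟨ψ k, h⟩ = (lam k : 𝕜) • ψ k) (hq0 : 0 < q) (hq1 : q < 1)
    (hα0 : 0 < α) (hα1 : α < 1) (hd : 0 ≤ d) {u : ℝ → ι → 𝕜} {f : ι → 𝕜}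
    (h : IsInverseSolution lam q α m T d φ ρ u f) (hf : MemSobolev lam d f) :
    ∃ (U : ℝ → H) (F : H),
      (∀ t ∈ Icc 0 T, eigenSeries ψ (U t) = u t) ∧ eigenSeries ψ F = f ∧
      ∀ t ∈ Ioc 0 T, (Summable fun n : ℕ => ‖caputoTerm 𝕜 q α U t n‖) ∧
        ∃ h : U t ∈ L.domain, caputo 𝕜 q α U t + L ⟨U t, h⟩ + (m : 𝕜) • U t = F := by
  -- The value `0` outside `[0, T]` is immaterial, since the points `t q^n` stay in the interval.
  have hex : ∀ t, ∃ v : H, t ∈ Icc 0 T → eigenSeries ψ v = u t := by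
    intro t
    by_cases ht : t ∈ Icc 0 T
    · obtain ⟨v, hv⟩ := (h.memLinfty.1 t ht).exists_eigenSeries_eq ψ hlam (by linarith)
      exact ⟨v, fun _ => hv⟩
    · exact ⟨0, fun h => absurd h ht⟩
  choose U hU using hex
  obtain ⟨F, hF⟩ := hf.exists_eigenSeries_eq ψ hlam hd
  refine ⟨U, F, hU, hF, fun t ht => ?_⟩
  have htn : ∀ n : ℕ, t * q ^ n ∈ Icc 0 T := fun n =>
    ⟨mul_nonneg ht.1.le (pow_pos hq0 n).le,
      (mul_le_of_le_one_right ht.1.le (pow_le_one₀ hq0.le hq1.le)).trans ht.2⟩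
  have hUn : ∀ n : ℕ, eigenSeries ψ (U (t * q ^ n)) = u (t * q ^ n) := fun n => hU _ (htn n)
  have hterm := eigenSeries_caputoTerm ψ hq0 hα0 hα1 ht.1 hUn
  have hmem : ∀ n, MemSobolev lam d (caputoTerm 𝕜 q α u t n) := by
    intro n
    rw [caputoTerm_eq_smul_kernelTerm hq0 hα0 hα1 ht.1]
    exact (((h.memW.memLinfty.1 _ (htn n)).sub hlam (h.memW.memLinfty.1 _ (htn (n + 1)))).smul
      hlam _).smul hlam _
  have hsum : Summable fun n : ℕ => ‖caputoTerm 𝕜 q α U t n‖ := by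
    refine Summable.of_nonneg_of_le (fun _ => norm_nonneg _) (fun n => ?_) (h.memW.summable t ht)
    rw [← hterm n]
    exact norm_le_sobolevNorm ψ hlam hd (by rw [hterm n]; exact hmem n)
  have hu := hU t (Ioc_subset_Icc_self ht)
  -- The two extra orders of `u t` bring its image under the operator into `H`, which places the
  -- vector in the domain.
  have hop : MemSobolev lam d (seriesOp lam (u t)) := by
    refine ((h.memLinfty.1 t (Ioc_subset_Icc_self ht)).of_norm_le_mul hlam zero_le_one
      fun k => ?_).1
    rw [seriesOp, norm_mul, RCLike.norm_ofReal, abs_of_nonneg (hlam k), one_mul]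
    exact mul_le_mul_of_nonneg_right (by linarith) (norm_nonneg _)
  obtain ⟨w, hw⟩ := hop.exists_eigenSeries_eq ψ hlam hd
  rw [← hu] at hw
  obtain ⟨hdom, hLw⟩ := mem_domain_of_seriesOp_eq ψ hL hψ hw
  refine ⟨hsum, hdom, eigenSeries_injective ψ ?_⟩
  rw [hLw, eigenSeries_add, eigenSeries_add, eigenSeries_smul, hw, hF, hu,
    eigenSeries_caputo ψ hq0 hq1 hα0 hα1 ht.1 hUn hsum.of_norm, h.equation t ht]

end HilbertSolution

theorem sq_le_of_le_mul_of_sq_le {x a r n : ℝ} (hx : 0 ≤ x) (h : x ≤ a * r) (hr : r ^ 2 ≤ 2 * n) :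
    x ^ 2 ≤ 2 * a ^ 2 * n := by
  have h1 : x ^ 2 ≤ (a * r) ^ 2 := pow_le_pow_left₀ hx h 2
  nlinarith [mul_le_mul_of_nonneg_left hr (sq_nonneg a)]

end

theorem theorem5p1 {𝕜 ι H : Type*} [RCLike 𝕜] [Countable ι] [NormedAddCommGroup H]
    [InnerProductSpace 𝕜 H] [CompleteSpace H]
    (L : H →ₗ.[𝕜] H) (hL : IsSelfAdjoint L)
    (ψ : HilbertBasis ι 𝕜 H) (lam : ι → ℝ) (hlam : ∀ k, 0 ≤ lam k)
    (hψ : ∀ k, ∃ h : ψ k ∈ L.domain, L ⟨ψ k, h⟩ = (lam k : 𝕜) • ψ k)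
    (q α m T : ℝ) (hq0 : 0 < q) (hq1 : q < 1) (hα0 : 0 < α) (hα1 : α < 1)
    (hm : 0 < m) (hT : 0 < T) :
    ∃ C : ℝ, 0 < C ∧ ∀ (d : ℝ) (φ ρ : ι → 𝕜),
      MemSobolev lam (d + 2) φ → MemSobolev lam (d + 2) ρ →
      ∃ (u : ℝ → ι → 𝕜) (f : ι → 𝕜),
        -- existence, with `u` in both function spaces
        IsInverseSolution lam q α m T d φ ρ u f ∧
        MemSobolev lam d f ∧
        -- for `d ≥ 0` everything takes place in `H`, with the operator `L` itself
        (0 ≤ d → ∃ (U : ℝ → H) (F : H),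
          (∀ t ∈ Icc 0 T, eigenSeries ψ (U t) = u t) ∧ eigenSeries ψ F = f ∧
          ∀ t ∈ Ioc 0 T, (Summable fun n : ℕ => ‖caputoTerm 𝕜 q α U t n‖) ∧
            ∃ h : U t ∈ L.domain, caputo 𝕜 q α U t + L ⟨U t, h⟩ + (m : 𝕜) • U t = F) ∧
        -- uniqueness
        (∀ (v : ℝ → ι → 𝕜) (g : ι → 𝕜), IsInverseSolution lam q α m T d φ ρ v g →
          (∀ t ∈ Icc 0 T, v t = u t) ∧ g = f) ∧
        -- the eigenfunction series of `u` and `f`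
        (∀ t ∈ Icc 0 T, SobolevHasSum lam (d + 2)
          (fun k => ((φ k - ρ k) * ((qMittagLeffler q α 1 (-(lam k + m) * t ^ α) - 1 : ℝ) : 𝕜) /
            ((1 - qMittagLeffler q α 1 (-(lam k + m) * T ^ α) : ℝ) : 𝕜)) • eigenSeries ψ (ψ k))
          (u t - φ)) ∧
        SobolevHasSum lam d
          (fun k => (((lam k + m : ℝ) : 𝕜) * (φ k - ρ k) /
            ((1 - qMittagLeffler q α 1 (-(lam k + m) * T ^ α) : ℝ) : 𝕜)) • eigenSeries ψ (ψ k))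
          (seriesOp lam φ + (m : 𝕜) • φ - f) ∧
        (∀ k, qMittagLeffler q α 1 (-(lam k + m) * T ^ α) < 1) ∧
        -- the estimates
        (∀ t ∈ Ioc 0 T,
          sobolevNorm lam d (caputo 𝕜 q α u t) ^ 2 + sobolevNorm lam (d + 2) (u t) ^ 2 ≤
            C * (sobolevNorm lam (d + 2) φ ^ 2 + sobolevNorm lam (d + 2) ρ ^ 2)) ∧
        sobolevNorm lam d f ^ 2 ≤
          C * (sobolevNorm lam (d + 2) φ ^ 2 + sobolevNorm lam (d + 2) ρ ^ 2) := by
  have hμ : ∀ k, m ≤ lam k + m := fun k => by linarith [hlam k]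
  have hδ := inv_pos.2 (modeGap_pos hq0 hq1 hα1 hm hT)
  have hlt : ∀ k, qMittagLeffler q α 1 (-(lam k + m) * T ^ α) < 1 := fun k => by
    have h1 := modeGap_pos hq0 hq1 hα1 hm hT
    have h2 := modeGap_le hq0 hq1 hα0 hα1 hm (hμ k) hT
    rw [mlMode] at h2
    linarith
  -- The three squares come from the bounds for the Caputo derivative, `u` and `f`; the factors `2`
  -- come from `(x + y)^2 ≤ 2 (x^2 + y^2)`. Their sum serves both estimates.
  refine ⟨2 * ((modeGap q α m T)⁻¹ * (1 + m)) ^ 2 + 2 * (1 + 2 * (modeGap q α m T)⁻¹) ^ 2 +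
    2 * ((1 + (modeGap q α m T)⁻¹) * (1 + m)) ^ 2, by positivity, fun d φ ρ hφ hρ => ?_⟩
  have hsol := isInverseSolution_inverseSol hlam hq0 hq1 hα0 hα1 hm hT hφ hρ
  have hsrc := inverseSource_bound hlam hq0 hq1 hα0 hα1 hm hT hφ hρ
  have hR := (hφ.norm_add_norm hlam hρ).2
  have hN : 0 ≤ sobolevNorm lam (d + 2) φ ^ 2 + sobolevNorm lam (d + 2) ρ ^ 2 := by positivity
  refine ⟨inverseSol lam q α m T φ ρ, inverseSource lam q α m T φ ρ, hsol, hsrc.1,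
    fun hd => hsol.exists_hilbert_solution hL ψ hlam hψ hq0 hq1 hα0 hα1 hd hsrc.1,
    fun v g hv => hv.unique hlam hq0 hq1 hα0 hα1 hm hT hsol, fun t ht => ?_, ?_, hlt,
    fun t ht => ?_, ?_⟩
  · have h := ((inverseSol_bound hlam hq0 hq1 hα0 hα1 hm hT hφ hρ ht.1).1.sub hlam
      hφ).sobolevHasSum ψ
    convert! h using 3 with k
    rw [Pi.sub_apply, inverseSol, modeSol, modeCoeff, mlMode, mlMode, add_sub_cancel_left,
      mul_div_right_comm]
  · have hmem : MemSobolev lam d (seriesOp lam φ + (m : 𝕜) • φ) := by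
      refine (hφ.of_norm_le_mul hlam (by linarith : 0 ≤ 1 + m) fun k => ?_).1
      have e : (seriesOp lam φ + (m : 𝕜) • φ) k = ((lam k + m : ℝ) : 𝕜) * φ k := by
        simp only [Pi.add_apply, Pi.smul_apply, smul_eq_mul, seriesOp]
        push_cast
        ring
      rw [e, norm_mul, RCLike.norm_ofReal, abs_of_nonneg (by linarith [hμ k])]
      exact add_mul_le_one_add_mul (hlam k) hm (norm_nonneg _)
    have h := (hmem.sub hlam hsrc.1).sobolevHasSum ψ
    convert! h using 3 with k
    simp only [Pi.sub_apply, Pi.add_apply, Pi.smul_apply, smul_eq_mul, seriesOp, inverseSource,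
      modeCoeff, mlMode]
    push_cast
    ring
  · rw [caputo_inverseSol hlam hq0 hq1 hα0 hα1 hm ht.1]
    have h1 := sq_le_of_le_mul_of_sq_le (sobolevNorm_nonneg _ _ _)
      (inverseCaputo_bound hlam hq0 hq1 hα0 hα1 hm hT hφ hρ ht.1.le).2 hR
    have h2 := sq_le_of_le_mul_of_sq_le (sobolevNorm_nonneg _ _ _)
      (inverseSol_bound hlam hq0 hq1 hα0 hα1 hm hT hφ hρ ht.1.le).2 hR
    refine (add_le_add h1 h2).trans ?_
    rw [← add_mul]
    refine mul_le_mul_of_nonneg_right ?_ hN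
    exact le_add_of_nonneg_right (by positivity)
  · refine (sq_le_of_le_mul_of_sq_le (sobolevNorm_nonneg _ _ _) hsrc.2 hR).trans ?_
    refine mul_le_mul_of_nonneg_right ?_ hN
    exact le_add_of_nonneg_left (by positivity)
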